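/- Fix $d,m\in\mathbb N$. Consider the linear Gaussian model $$\theta_i=A_i\theta_{i-1}+w_i\ (i\ge 2),\qquad y_i=X_i^\top\theta_i+v_i\ (i\ge 1),$$ where $A_i\in\mathbb R^{d\times d}$ and $X_i\in\mathbb R^{d\times m}$ are fixed matrices and where $\theta_1\sim\mathcal N(\mu_1,\Sigma_1)$, $w_i\sim\mathcal N(0,Q_i)$ $(i\ge2)$ and $v_i\sim\mathcal N(0,R_i)$ $(i\ge1)$ are mutually independent, with $\mu_1\in\mathbb R^d$ and with positive definite $\Sigma_1,Q_i\in\mathbb R^{d\times d}$, $R_i\in\mathbb R^{m\times m}$. For $1\le i\le t$ let $\theta_{i|t}$ be a maximum a posteriori (MAP) estimate of $\theta_i$, i.e. almost surely a global maximizer of the (continuous) conditional density $p(\theta_i\mid y_1,\dots,y_t)$, and let $$\Sigma_{i|t}=\mathbb E\big[(\theta_i-\theta_{i|t})(\theta_i-\theta_{i|t})^\top\,\big|\,y_1,\dots,y_t\big]$$ be its error covariance. Then: 1. A random vector is a MAP estimate of $\theta_i$ given $y_1,\dots,y_t$ if and only if it is almost surely equal to $\mathbb E[\theta_i\mid y_1,\dots,y_t]$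 (for all $1\le i\le t$). 2. For all $1\le i\le s\le t$, almost surely $\Sigma_{i|t}\preceq\Sigma_{i|s}$ in the positive semidefinite order, the errors $\theta_i-\theta_{i|s}$ and $\theta_i-\theta_{i|t}$ are square integrable, and $$\mathbb E\big[\|\theta_i-\theta_{i|t}\|_2^2\big]\le\mathbb E\big[\|\theta_i-\theta_{i|s}\|_2^2\big].$$ 3. The Kalman filter followed by the Rauch–Tung–Striebel smoother computes these estimates, so that its estimates of past tasks improve in the sense of 2: define $\hat\theta_{1|0}=\mu_1$, $\hat\Sigma_{1|0}=\Sigma_1$ and, for $t\ge1$, with $K_t=\hat\Sigma_{t|t-1}X_t(R_t+X_t^\top\hat\Sigma_{t|t-1}X_t)^{-1}$, $$\hat\theta_{t|t}=\hat\theta_{t|t-1}-K_t(X_t^\top\hat\theta_{t|t-1}-y_t),\qquad \hat\Sigma_{t|t}=\hat\Sigma_{t|t-1}-K_tX_t^\top\hat\Sigma_{t|t-1},$$ $$\hat\theta_{t+1|t}=A_{t+1}\hat\theta_{t|t},\qquad \hat\Sigma_{t+1|t}=Q_{t+1}+A_{t+1}\hat\Sigma_{t|t}A_{t+1}^\top,$$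 and, for $i=t-1,\dots,1$, with $L_i=\hat\Sigma_{i|i}A_{i+1}^\top\hat\Sigma_{i+1|i}^{-1}$, $$\hat\theta_{i|t}=\hat\theta_{i|i}+L_i(\hat\theta_{i+1|t}-\hat\theta_{i+1|i}),\qquad \hat\Sigma_{i|t}=\hat\Sigma_{i|i}+L_i(\hat\Sigma_{i+1|t}-\hat\Sigma_{i+1|i})L_i^\top.$$ Then for all $1\le i\le t$ the vector $\hat\theta_{i|t}$ is a MAP estimate of $\theta_i$ given $y_1,\dots,y_t$, and $\Sigma_{i|t}=\hat\Sigma_{i|t}$ almost surely. -/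

import Mathlib

open MeasureTheory ProbabilityTheory

namespace LinearGaussian

/-- `ℝⁿ` with the Euclidean norm. -/
abbrev Vec (n : ℕ) : Type := EuclideanSpace ℝ (Fin n)

/-- The matrix-vector product, as a map between Euclidean spaces. -/
noncomputable def act {k n : ℕ} (B : Matrix (Fin k) (Fin n) ℝ) (x : Vec n) : Vec k :=
  WithLp.toLp 2 (B.mulVec x.ofLp)

/-- The known parameters of a linear Gaussian model. Tasks are numbered from `1`; the values
`A 0`, `A 1`, `X 0`, `Q 0`, `Q 1`, `R 0` are not used. -/
structure Params (d m : ℕ) where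
  /-- `A i` is the transition matrix from task `i - 1` to task `i`, for `i ≥ 2`. -/
  A : ℕ → Matrix (Fin d) (Fin d) ℝ
  /-- `X i` is the data matrix of task `i`, for `i ≥ 1`. -/
  X : ℕ → Matrix (Fin d) (Fin m) ℝ
  /-- mean of the first state -/
  mean₁ : Vec d
  /-- covariance of the first state -/
  cov₁ : Matrix (Fin d) (Fin d) ℝ
  /-- covariances of the transition noise -/
  Q : ℕ → Matrix (Fin d) (Fin d) ℝ
  /-- covariances of the measurement noise -/
  R : ℕ → Matrix (Fin m) (Fin m) ℝ
  cov₁_posDef : cov₁.PosDef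
  Q_posDef : ∀ i, 2 ≤ i → (Q i).PosDef
  R_posDef : ∀ i, 1 ≤ i → (R i).PosDef

/-- Labels for the sources of randomness: `init` is the first state, `trans n` is the transition
noise of task `n + 2`, and `meas n` is the measurement noise of task `n + 1`. -/
inductive Source : Type
  | init : Source
  | trans : ℕ → Source
  | meas : ℕ → Source

/-- The dimension of each source of randomness. -/
def Source.dim (d m : ℕ) : Source → ℕ
  | .init => d
  | .trans _ => d
  | .meas _ => m

/-- The family consisting of `θ 1`, all `w i` with `i ≥ 2` and all `v i` with `i ≥ 1`. -/
def sources {Ω : Type*} {d m : ℕ} (θ w : ℕ → Ω → Vec d) (v : ℕ → Ω → Vec m) :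
    (k : Source) → Ω → Vec (k.dim d m)
  | .init => θ 1
  | .trans n => w (n + 2)
  | .meas n => v (n + 1)

/-- The linear Gaussian model with parameters `M`, on the probability space `(Ω, P)`:
`θ i = A i θ (i-1) + w i` for `i ≥ 2` and `y i = (X i)ᵀ θ i + v i` for `i ≥ 1`, where
`θ 1 ∼ N(mean₁, cov₁)`, `w i ∼ N(0, Q i)`, `v i ∼ N(0, R i)` are mutually independent. -/
structure IsLGM {Ω : Type*} [MeasurableSpace Ω] (P : Measure Ω) {d m : ℕ} (M : Params d m)
    (θ : ℕ → Ω → Vec d) (y : ℕ → Ω → Vec m) (w : ℕ → Ω → Vec d) (v : ℕ → Ω → Vec m) : Prop where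
  measurable_sources : ∀ k, Measurable (sources θ w v k)
  law_init : HasLaw (θ 1) (multivariateGaussian M.mean₁ M.cov₁) P
  law_trans : ∀ i, 2 ≤ i → HasLaw (w i) (multivariateGaussian 0 (M.Q i)) P
  law_meas : ∀ i, 1 ≤ i → HasLaw (v i) (multivariateGaussian 0 (M.R i)) P
  indep : iIndepFun (sources θ w v) P
  state_eq : ∀ i, 2 ≤ i → ∀ ω, θ i ω = act (M.A i) (θ (i - 1) ω) + w i ω
  meas_eq : ∀ i, 1 ≤ i → ∀ ω, y i ω = act (M.X i).transpose (θ i ω) + v i ω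

/-- The stacked observations `(y 1, …, y t)`. -/
def obs {Ω : Type*} {m : ℕ} (y : ℕ → Ω → Vec m) (t : ℕ) (ω : Ω) : Fin t → Vec m :=
  fun k => y (k + 1) ω

/-- The σ-algebra generated by `y 1, …, y t`. -/
abbrev obsSigma {Ω : Type*} {m : ℕ} (y : ℕ → Ω → Vec m) (t : ℕ) : MeasurableSpace Ω :=
  MeasurableSpace.comap (obs y t) inferInstance

/-- `p` is the (continuous version of the) conditional probability density function of `Z`
given `Y`: for almost every value `u` of `Y`, `p u` is a continuous Lebesgue density of the
conditional distribution of `Z` given `Y = u`. Continuity pins down the density everywhere,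
so that its maximizers are meaningful. -/
def IsCondPDF {Ω F : Type*} [MeasurableSpace Ω] [MeasurableSpace F] (P : Measure Ω)
    [IsFiniteMeasure P] {d : ℕ} (Z : Ω → Vec d) (Y : Ω → F) (p : F → Vec d → ℝ) : Prop :=
  ∀ᵐ u ∂(P.map Y), Continuous (p u) ∧ (∀ x, 0 ≤ p u x) ∧
    condDistrib Z Y P u = volume.withDensity (fun x => ENNReal.ofReal (p u x))

/-- `g` is a maximum a posteriori estimate of `Z` given `Y`: almost surely `g` is a global
maximizer of the conditional density of `Z` at the observed value of `Y`. -/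
def IsMAP {Ω F : Type*} [MeasurableSpace Ω] [MeasurableSpace F] (P : Measure Ω)
    [IsFiniteMeasure P] {d : ℕ} (Z : Ω → Vec d) (Y : Ω → F) (g : Ω → Vec d) : Prop :=
  ∃ p : F → Vec d → ℝ, IsCondPDF P Z Y p ∧ ∀ᵐ ω ∂P, ∀ x, p (Y ω) x ≤ p (Y ω) (g ω)

/-- The error covariance `E[(Z - g)(Z - g)ᵀ | 𝓖]`, a random matrix, of the estimate `g` of `Z`;
conditional expectations are taken entrywise. -/
noncomputable def errCov {Ω : Type*} [MeasurableSpace Ω] (P : Measure Ω) {d : ℕ}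
    (𝓖 : MeasurableSpace Ω) (Z g : Ω → Vec d) (ω : Ω) : Matrix (Fin d) (Fin d) ℝ :=
  Matrix.of fun a b => (P[fun ω' => (Z ω' - g ω') a * (Z ω' - g ω') b | 𝓖]) ω

/-! The Kalman filter and the Rauch-Tung-Striebel smoother. -/

namespace Params

variable {d m : ℕ} (M : Params d m)

/-- The Kalman gain at task `t`, computed from the predicted covariance `S`. -/
noncomputable def gain (t : ℕ) (S : Matrix (Fin d) (Fin d) ℝ) : Matrix (Fin d) (Fin m) ℝ :=
  S * M.X t * (M.R t + (M.X t).transpose * S * M.X t)⁻¹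

/-- Correction step for the covariance. -/
noncomputable def correctCov (t : ℕ) (S : Matrix (Fin d) (Fin d) ℝ) :
    Matrix (Fin d) (Fin d) ℝ :=
  S - M.gain t S * (M.X t).transpose * S

/-- Correction step for the mean, given the predicted covariance `S` and the measurement `u`. -/
noncomputable def correctMean (t : ℕ) (S : Matrix (Fin d) (Fin d) ℝ) (x : Vec d) (u : Vec m) :
    Vec d :=
  x - act (M.gain t S) (act (M.X t).transpose x - u)

/-- `predCov t` is the covariance `Σ_{t|t-1}` computed by the Kalman filter, for `t ≥ 1`
(the value at `0` is not used). -/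
noncomputable def predCov : ℕ → Matrix (Fin d) (Fin d) ℝ
  | 0 => M.cov₁
  | 1 => M.cov₁
  | t + 2 => M.Q (t + 2) +
      M.A (t + 2) * M.correctCov (t + 1) (predCov (t + 1)) * (M.A (t + 2)).transpose

/-- `filtCov t` is the covariance `Σ_{t|t}` computed by the Kalman filter, for `t ≥ 1`. -/
noncomputable def filtCov (t : ℕ) : Matrix (Fin d) (Fin d) ℝ :=
  M.correctCov t (M.predCov t)

/-- `predMean u t` is the estimate `θ_{t|t-1}` computed by the Kalman filter from the measurements
`u 1, u 2, …`, for `t ≥ 1` (the value at `0` is not used). -/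
noncomputable def predMean (u : ℕ → Vec m) : ℕ → Vec d
  | 0 => M.mean₁
  | 1 => M.mean₁
  | t + 2 => act (M.A (t + 2))
      (M.correctMean (t + 1) (M.predCov (t + 1)) (predMean u (t + 1)) (u (t + 1)))

/-- `filtMean u t` is the estimate `θ_{t|t}` computed by the Kalman filter, for `t ≥ 1`. -/
noncomputable def filtMean (u : ℕ → Vec m) (t : ℕ) : Vec d :=
  M.correctMean t (M.predCov t) (M.predMean u t) (u t)

/-- The backward Kalman gain `Σ_{i|i} A_{i+1}ᵀ Σ_{i+1|i}⁻¹`. -/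
noncomputable def backGain (i : ℕ) : Matrix (Fin d) (Fin d) ℝ :=
  M.filtCov i * (M.A (i + 1)).transpose * (M.predCov (i + 1))⁻¹

/-- `rtsCov n i` is the covariance `Σ_{i|i+n}` computed by the smoother, which starts at
`Σ_{i+n|i+n}` and goes backward `n` steps. -/
noncomputable def rtsCov : ℕ → ℕ → Matrix (Fin d) (Fin d) ℝ
  | 0, i => M.filtCov i
  | n + 1, i => M.filtCov i +
      M.backGain i * (rtsCov n (i + 1) - M.predCov (i + 1)) * (M.backGain i).transpose

/-- `rtsMean u n i` is the estimate `θ_{i|i+n}` computed by the smoother, which starts at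
`θ_{i+n|i+n}` and goes backward `n` steps. -/
noncomputable def rtsMean (u : ℕ → Vec m) : ℕ → ℕ → Vec d
  | 0, i => M.filtMean u i
  | n + 1, i => M.filtMean u i +
      act (M.backGain i) (rtsMean u n (i + 1) - M.predMean u (i + 1))

end Params

end LinearGaussian

/-! Everything reduces to orthogonality in L². All variables of the model are affine combinations of
independent Gaussian vectors, so they are jointly Gaussian, and there a centered vector orthogonal
to the observations is independent of them. Suppose an estimate is an affine function `G` of `(y 1,
…, y t)` whose error `Z - G (Y)` is orthogonal to the constants and to the observations, with
positive definite second moment `S`. Then the error is independent of `Y` with law `N(0, S)`, so the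
conditional law of `Z` given `Y = u` is `N(G u, S)`. Its continuous density has `G u` as its only
maximizer, `G (Y)` is the conditional mean, and the conditional error covariance is the constant `S`
(`isMAP_iff_of_indepFun`, `condExp_eq_of_indepFun`, `errCov_eq_of_indepFun`).

It remains to show that the recursions produce such estimates (`IsLinearEstimate`). Filter and
smoother share one computation: if `e` and `z` are orthogonal with second moments `S`, `R`, and `K
(R + B S Bᵀ) = S Bᵀ`, then `e - K (B e + z)` is orthogonal to `B e + z` and has second moment `S - K
B S`. This is the correction step with `B = Xᵀ` and `z = v`; with `B = A` and `z = w` it estimates a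
state from the next one, which drives the backward step. The Joseph form keeps the covariances
positive definite.

Monotonicity is Pythagoras: the error at time `s` is the error at time `t ≥ s` plus a combination of
`y 1, …, y t`, and these are orthogonal. Taking traces gives the mean squared errors. -/

namespace LinearGaussian

/-! ### Densities of Gaussian measures. -/

/-- The standard Gaussian measure has density proportional to `exp (-‖x‖ ^ 2 / 2)`. -/
theorem stdGaussian_eq_withDensity (n : ℕ) :
    stdGaussian (Vec n) = volume.withDensity fun x : Vec n =>
      ENNReal.ofReal (((2 * Real.pi) ^ (n / 2 : ℝ))⁻¹ * Real.exp (-(1 / 2) * ‖x‖ ^ 2)) := by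
  have hpos : (0 : ℝ) < (2 * Real.pi) ^ (n / 2 : ℝ) := by positivity
  have hint : Integrable fun x : Vec n => Real.exp (-(1 / 2) * ‖x‖ ^ 2) := by
    have h := (GaussianFourier.integrable_cexp_neg_mul_sq_norm_add (b := (1 / 2 : ℂ))
      (by norm_num) 0 (0 : Vec n)).re
    refine h.congr (Filter.Eventually.of_forall fun x => ?_)
    have : (-(1 / 2 : ℂ) * (‖x‖ : ℂ) ^ 2 + 0 * ((inner ℝ (0 : Vec n) x : ℝ) : ℂ))
        = ((-(1 / 2) * ‖x‖ ^ 2 : ℝ) : ℂ) := by push_cast; ring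
    simp only [this]
    exact Complex.exp_ofReal_re _
  set f : Vec n → ℝ := fun x =>
    ((2 * Real.pi) ^ (n / 2 : ℝ))⁻¹ * Real.exp (-(1 / 2) * ‖x‖ ^ 2) with hf
  have hf0 : ∀ x, 0 ≤ f x := fun x => by positivity
  have hfint : Integrable f := hint.const_mul _
  have hfm : Measurable f := by fun_prop
  have : IsFiniteMeasure ((volume : Measure (Vec n)).withDensity fun x => ENNReal.ofReal (f x)) :=
    isFiniteMeasure_withDensity_ofReal hfint.2
  -- Comparing characteristic functions of finite measures also settles the normalizing constant: no
  -- separate check of total mass one is needed.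
  refine Measure.ext_of_charFun ?_
  ext t
  rw [charFun_stdGaussian, charFun_apply, integral_withDensity_eq_integral_toReal_smul
    (by fun_prop) (Filter.Eventually.of_forall fun _ => ENNReal.ofReal_lt_top)]
  -- The linear coefficient `I` turns the Gaussian integral into the characteristic function at `t`.
  have key := GaussianFourier.integral_cexp_neg_mul_sq_norm_add (b := (1 / 2 : ℂ))
      (by norm_num) Complex.I t
  have hterm : ∀ x : Vec n, (ENNReal.ofReal (f x)).toReal •
      Complex.exp ((inner ℝ x t : ℝ) * Complex.I) =
      ((((2 * Real.pi) ^ (n / 2 : ℝ))⁻¹ : ℝ) : ℂ) *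
        Complex.exp (-(1 / 2 : ℂ) * (‖x‖ : ℂ) ^ 2 + Complex.I * (inner ℝ t x : ℝ)) := by
    intro x
    rw [ENNReal.toReal_ofReal (hf0 x), Complex.real_smul, Complex.exp_add, real_inner_comm x t]
    simp only [hf]
    push_cast
    ring_nf
  rw [integral_congr_ae (Filter.Eventually.of_forall hterm), integral_const_mul, key]
  have h2 : ((Real.pi : ℂ) / (1 / 2 : ℂ)) ^ ((Module.finrank ℝ (Vec n) : ℂ) / 2) =
      (((2 * Real.pi) ^ (n / 2 : ℝ) : ℝ) : ℂ) := by
    rw [Complex.ofReal_cpow (by positivity)]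
    simp
    ring_nf
  rw [h2, ← mul_assoc, ← Complex.ofReal_mul, inv_mul_cancel₀ hpos.ne']
  simp
  ring_nf

/-- A nondegenerate multivariate Gaussian measure has a density proportional to
`exp (-‖T (x - μ)‖ ^ 2 / 2)`, with `T` injective. -/
theorem exists_multivariateGaussian_eq_withDensity {n : ℕ} {S : Matrix (Fin n) (Fin n) ℝ}
    (hS : S.PosDef) : ∃ (C : ℝ) (T : Vec n →L[ℝ] Vec n), 0 < C ∧ Function.Injective T ∧
      ∀ μ : Vec n, multivariateGaussian μ S = volume.withDensity fun x =>
        ENNReal.ofReal (C * Real.exp (-(1 / 2) * ‖T (x - μ)‖ ^ 2)) := by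
  open scoped MatrixOrder in
  set B := CFC.sqrt S with hB
  have hBB : B * B = S := CFC.sqrt_mul_sqrt_self S hS.posSemidef.nonneg
  have hdet : IsUnit B.det := by
    have : IsUnit (B * B).det := by
      rw [hBB]; exact (Matrix.isUnit_iff_isUnit_det _).1 hS.isUnit
    rw [Matrix.det_mul] at this
    exact isUnit_of_mul_isUnit_left this
  set F := Matrix.toEuclideanCLM (n := Fin n) (𝕜 := ℝ) B
  set T := Matrix.toEuclideanCLM (n := Fin n) (𝕜 := ℝ) B⁻¹
  have hTF : ∀ x, T (F x) = x := fun x => by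
    have : T * F = 1 := by
      rw [← map_mul, Matrix.nonsing_inv_mul _ hdet, map_one]
    exact congrArg (fun G : Vec n →L[ℝ] Vec n => G x) this
  have hFT : ∀ x, F (T x) = x := fun x => by
    have : F * T = 1 := by
      rw [← map_mul, Matrix.mul_nonsing_inv _ hdet, map_one]
    exact congrArg (fun G : Vec n →L[ℝ] Vec n => G x) this
  have hdF : LinearMap.det (F : Vec n →ₗ[ℝ] Vec n) ≠ 0 := by
    have h1 : (T : Vec n →ₗ[ℝ] Vec n) ∘ₗ (F : Vec n →ₗ[ℝ] Vec n) = LinearMap.id := by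
      ext1 x; exact hTF x
    intro h0
    have := congrArg LinearMap.det h1
    rw [LinearMap.det_comp, h0, mul_zero, LinearMap.det_id] at this
    exact zero_ne_one this
  -- The Jacobian factor of the substitution `x ↦ μ + F x`, whose inverse is `x ↦ T (x - μ)`.
  set D : ℝ := |(LinearMap.det (F : Vec n →ₗ[ℝ] Vec n))⁻¹|
  have hD : 0 < D := abs_pos.2 (inv_ne_zero hdF)
  refine ⟨D * ((2 * Real.pi) ^ (n / 2 : ℝ))⁻¹, T, by positivity,
    Function.LeftInverse.injective hFT, fun μ => ?_⟩
  have hmap : (volume : Measure (Vec n)).map (fun x => μ + F x) = ENNReal.ofReal D • volume := by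
    have h1 : (fun x => μ + F x) = (fun x => μ + x) ∘ (F : Vec n →ₗ[ℝ] Vec n) := rfl
    have hFm : Measurable (F : Vec n →ₗ[ℝ] Vec n) := F.measurable
    rw [h1, ← Measure.map_map (measurable_const_add μ) hFm,
      Measure.map_linearMap_addHaar_eq_smul_addHaar _ hdF, Measure.map_smul, map_add_left_eq_self]
  rw [multivariateGaussian, stdGaussian_eq_withDensity]
  ext s hs
  have hm : Measurable fun x : Vec n => μ + F x := by fun_prop
  rw [Measure.map_apply hm hs, withDensity_apply _ (hm hs), withDensity_apply _ hs]
  have e1 : ∀ x : Vec n, ENNReal.ofReal (D * ((2 * Real.pi) ^ (n / 2 : ℝ))⁻¹ *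
      Real.exp (-(1 / 2) * ‖T (x - μ)‖ ^ 2)) = ENNReal.ofReal D *
      ENNReal.ofReal (((2 * Real.pi) ^ (n / 2 : ℝ))⁻¹ *
        Real.exp (-(1 / 2) * ‖T (x - μ)‖ ^ 2)) := fun x => by
    rw [mul_assoc, ENNReal.ofReal_mul hD.le]
  simp_rw [e1]
  rw [lintegral_const_mul _ (by fun_prop), ← smul_eq_mul (ENNReal.ofReal D),
    ← lintegral_smul_measure,
    ← Measure.restrict_smul, ← hmap, setLIntegral_map hs (by fun_prop) hm]
  refine lintegral_congr fun x => ?_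
  rw [add_sub_cancel_left, hTF]

/-! ### Conditioning when the error is independent of the data. -/

/-- The conditional distribution of `G (Y) + e` given `Y`, when `e` is independent of `Y`. -/
theorem condDistrib_add_of_indepFun {Ω F : Type*} [MeasurableSpace Ω] [MeasurableSpace F]
    {P : Measure Ω} [IsProbabilityMeasure P] {n : ℕ} {Y : Ω → F} {G : F → Vec n} {e : Ω → Vec n}
    (hY : Measurable Y) (hG : Measurable G) (he : Measurable e) (hind : IndepFun Y e P) :
    ∀ᵐ u ∂(P.map Y), condDistrib (fun ω => G (Y ω) + e ω) Y P u =
      (P.map e).map (fun x => G u + x) := by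
  have : IsProbabilityMeasure (P.map e) := Measure.isProbabilityMeasure_map he.aemeasurable
  have : IsProbabilityMeasure (P.map Y) := Measure.isProbabilityMeasure_map hY.aemeasurable
  have hadd : Measurable fun q : F × Vec n => G q.1 + q.2 := by fun_prop
  -- The candidate kernel: freeze `Y = u` and translate the law of `e` by `G u`. Uniqueness of
  -- disintegration identifies it with `condDistrib`.
  let κ : Kernel F (Vec n) := (Kernel.id ×ₖ Kernel.const F (P.map e)).map fun q => G q.1 + q.2
  have hκ : ∀ u, κ u = (P.map e).map (fun x => G u + x) := fun u => by
    simp only [κ]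
    rw [Kernel.map_apply _ hadd, Kernel.prod_apply, Kernel.id_apply, Kernel.const_apply,
      Measure.dirac_prod, Measure.map_map hadd (by fun_prop)]
    rfl
  have hZ : Measurable fun ω => G (Y ω) + e ω := by fun_prop
  have : IsMarkovKernel κ := Kernel.IsMarkovKernel.map _ hadd
  have h := condDistrib_ae_eq_of_measure_eq_compProd (μ := P) Y hZ.aemeasurable (κ := κ) ?_
  · filter_upwards [h] with u hu
    rw [hu, hκ]
  · have hm : Measurable fun q : F × Vec n => (q.1, G q.1 + q.2) := by fun_prop
    have hpair : (fun ω => (Y ω, G (Y ω) + e ω)) =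
        (fun q : F × Vec n => (q.1, G q.1 + q.2)) ∘ fun ω => (Y ω, e ω) := rfl
    rw [hpair, ← Measure.map_map hm (hY.prodMk he),
      (indepFun_iff_map_prod_eq_prod_map_map hY.aemeasurable he.aemeasurable).1 hind]
    ext s hs
    rw [Measure.map_apply hm hs, Measure.prod_apply (hm hs), Measure.compProd_apply hs]
    refine lintegral_congr fun u => ?_
    rw [hκ, Measure.map_apply (by fun_prop) (measurable_prodMk_left hs)]
    rfl

theorem multivariateGaussian_map_const_add {n : ℕ} (c : Vec n) (S : Matrix (Fin n) (Fin n) ℝ) :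
    (multivariateGaussian 0 S).map (fun x => c + x) = multivariateGaussian c S := by
  rw [multivariateGaussian, Measure.map_map (by fun_prop) (by fun_prop)]
  simp only [zero_add]
  rfl

section Decomposition

variable {Ω F : Type*} [MeasurableSpace Ω] [MeasurableSpace F] {P : Measure Ω}
  [IsProbabilityMeasure P] {n : ℕ} {S : Matrix (Fin n) (Fin n) ℝ} {Z : Ω → Vec n} {Y : Ω → F}
  {G : F → Vec n}

/-- If `Z - G (Y)` is independent of `Y` with a nondegenerate centered Gaussian law, then the MAP
estimates of `Z` given `Y` are the random vectors almost surely equal to `G (Y)`. -/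
theorem isMAP_iff_of_indepFun (hS : S.PosDef) (hZ : Measurable Z) (hY : Measurable Y)
    (hG : Measurable G) (hind : IndepFun Y (fun ω => Z ω - G (Y ω)) P)
    (hlaw : P.map (fun ω => Z ω - G (Y ω)) = multivariateGaussian 0 S) (g : Ω → Vec n) :
    IsMAP P Z Y g ↔ g =ᵐ[P] fun ω => G (Y ω) := by
  obtain ⟨C, T, hC, hT, hdens⟩ := exists_multivariateGaussian_eq_withDensity hS
  set p₀ : F → Vec n → ℝ := fun u x => C * Real.exp (-(1 / 2) * ‖T (x - G u)‖ ^ 2) with hp₀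
  have hcont : ∀ u, Continuous (p₀ u) := fun u => by simp only [hp₀]; fun_prop
  have hnonneg : ∀ u x, 0 ≤ p₀ u x := fun u x => by positivity
  have hcd : ∀ᵐ u ∂(P.map Y), condDistrib Z Y P u =
      volume.withDensity (fun x => ENNReal.ofReal (p₀ u x)) := by
    have h := condDistrib_add_of_indepFun (G := G) hY hG (by fun_prop) hind
    simp only [add_sub_cancel, hlaw, multivariateGaussian_map_const_add] at h
    filter_upwards [h] with u hu
    rw [hu, hdens]
  constructor
  · rintro ⟨p, hp, hmax⟩
    -- Densities of the same measure agree almost everywhere; both being continuous, they agree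
    -- everywhere, so the maximizer does not depend on the version.
    have h1 : ∀ᵐ u ∂(P.map Y), p u = p₀ u := by
      filter_upwards [hp, hcd] with u ⟨hc, h0, hu⟩ hu'
      have h2 : (fun x => ENNReal.ofReal (p u x)) =ᵐ[volume] fun x => ENNReal.ofReal (p₀ u x) :=
        (withDensity_eq_iff_of_sigmaFinite (by fun_prop)
          (ENNReal.continuous_ofReal.comp (hcont u)).measurable.aemeasurable).1 (hu.symm.trans hu')
      have h3 := (Continuous.ae_eq_iff_eq volume (ENNReal.continuous_ofReal.comp hc)
        (ENNReal.continuous_ofReal.comp (hcont u))).1 h2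
      ext x
      exact (ENNReal.ofReal_eq_ofReal_iff (h0 x) (hnonneg u x)).1 (congrFun h3 x)
    filter_upwards [ae_of_ae_map hY.aemeasurable h1, hmax] with ω hω hm
    -- Maximality tested against the center `G (Y ω)` forces the exponent at `g ω` to vanish, and
    -- `T` is injective.
    have h4 := hm (G (Y ω))
    rw [hω] at h4
    simp only [hp₀, sub_self, map_zero, norm_zero] at h4
    have h5 := Real.exp_le_exp.1 (le_of_mul_le_mul_left h4 hC)
    have h6 : ‖T (g ω - G (Y ω))‖ = 0 := by
      have := sq_nonneg ‖T (g ω - G (Y ω))‖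
      exact pow_eq_zero_iff two_ne_zero |>.1 (by linarith)
    exact sub_eq_zero.1 (hT ((norm_eq_zero.1 h6).trans (map_zero T).symm))
  · intro hg
    refine ⟨p₀, ?_, ?_⟩
    · filter_upwards [hcd] with u hu using ⟨hcont u, hnonneg u, hu⟩
    · filter_upwards [hg] with ω hω x
      simp only [hω, hp₀, sub_self, map_zero, norm_zero]
      refine mul_le_mul_of_nonneg_left (Real.exp_le_exp.2 ?_) hC.le
      have := sq_nonneg ‖T (x - G (Y ω))‖
      linarith

theorem condExp_eq_of_indepFun (hZ : Measurable Z) (hY : Measurable Y)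
    (hG : Measurable G) (hind : IndepFun Y (fun ω => Z ω - G (Y ω)) P)
    (hlaw : P.map (fun ω => Z ω - G (Y ω)) = multivariateGaussian 0 S) (hZint : Integrable Z P) :
    P[Z | MeasurableSpace.comap Y inferInstance] =ᵐ[P] fun ω => G (Y ω) := by
  set e : Ω → Vec n := fun ω => Z ω - G (Y ω) with he
  have hem : Measurable e := by fun_prop
  have heint : Integrable e P := by
    have h : Integrable id (P.map e) := by rw [hlaw]; exact IsGaussian.integrable_id
    exact h.comp_measurable hem
  have hGint : Integrable (fun ω => G (Y ω)) P := by
    refine (hZint.sub heint).congr (Filter.Eventually.of_forall fun ω => ?_)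
    simp [he]
  have hmean : ∫ ω, e ω ∂P = 0 := by
    have : ∫ x, x ∂(P.map e) = ∫ ω, e ω ∂P :=
      integral_map hem.aemeasurable aestronglyMeasurable_id
    rw [← this, hlaw, integral_id_multivariateGaussian]
  have h1 : P[e | MeasurableSpace.comap Y inferInstance] =ᵐ[P] fun _ => ∫ ω, e ω ∂P :=
    condExp_indep_eq hem.comap_le hY.comap_le (comap_measurable e).stronglyMeasurable hind.symm
  have h2 : P[fun ω => G (Y ω) | MeasurableSpace.comap Y inferInstance] = fun ω => G (Y ω) :=
    condExp_of_stronglyMeasurable hY.comap_le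
      (hG.comp (comap_measurable Y)).stronglyMeasurable hGint
  have h3 := condExp_add hGint heint (MeasurableSpace.comap Y inferInstance)
  have h4 : (fun ω => G (Y ω)) + e = Z := by ext1 ω; simp [he]
  rw [h4, h2] at h3
  filter_upwards [h3, h1] with ω h3 h1
  rw [h3, Pi.add_apply, h1, hmean, add_zero]

/-- Products of error coordinates are independent of `Y`, so conditioning leaves only their
expectations; this is why the conditional covariance is deterministic. -/
theorem errCov_eq_of_indepFun (hZ : Measurable Z) (hY : Measurable Y) (hG : Measurable G)
    (hind : IndepFun Y (fun ω => Z ω - G (Y ω)) P) {g : Ω → Vec n}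
    (hg : g =ᵐ[P] fun ω => G (Y ω)) :
    ∀ᵐ ω ∂P, errCov P (MeasurableSpace.comap Y inferInstance) Z g ω =
      Matrix.of fun a b => ∫ ω', (Z ω' - G (Y ω')) a * (Z ω' - G (Y ω')) b ∂P := by
  set e : Ω → Vec n := fun ω => Z ω - G (Y ω) with he
  have hem : Measurable e := by fun_prop
  have h : ∀ a b : Fin n, P[fun ω' => (Z ω' - g ω') a * (Z ω' - g ω') b |
      MeasurableSpace.comap Y inferInstance] =ᵐ[P] fun _ => ∫ ω', e ω' a * e ω' b ∂P := by
    intro a b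
    have hc : (fun ω' => (Z ω' - g ω') a * (Z ω' - g ω') b) =ᵐ[P] fun ω' => e ω' a * e ω' b := by
      filter_upwards [hg] with ω hω
      rw [hω]
    refine (condExp_congr_ae hc).trans ?_
    have hm : Measurable fun x : Vec n => x a * x b := by fun_prop
    exact condExp_indep_eq hem.comap_le hY.comap_le
      (hm.comp (comap_measurable e)).stronglyMeasurable hind.symm
  have h' := ae_all_iff.2 fun a => ae_all_iff.2 (h a)
  filter_upwards [h'] with ω hω
  ext a b
  exact hω a b

end Decomposition

/-! ### Random vectors with coordinates in a linear space of random variables. -/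

section Coordinates

variable {Ω : Type*} {k n : ℕ}

theorem act_apply (B : Matrix (Fin k) (Fin n) ℝ) (x : Vec n) (a : Fin k) :
    act B x a = ∑ b, B a b * x b := rfl

theorem act_sub (B : Matrix (Fin k) (Fin n) ℝ) (x y : Vec n) :
    act B (x - y) = act B x - act B y := by
  ext a; simp [act_apply, mul_sub, Finset.sum_sub_distrib]

/-- All coordinates of the random vector `U` belong to the space `𝒮` of random variables. -/
def CoordsIn (𝒮 : Submodule ℝ (Ω → ℝ)) (U : Ω → Vec n) : Prop :=
  ∀ a, (fun ω => U ω a) ∈ 𝒮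

namespace CoordsIn

variable {𝒮 𝒯 : Submodule ℝ (Ω → ℝ)} {U V : Ω → Vec n}

theorem mono (h : 𝒮 ≤ 𝒯) (hU : CoordsIn 𝒮 U) : CoordsIn 𝒯 U := fun a => h (hU a)

theorem add (hU : CoordsIn 𝒮 U) (hV : CoordsIn 𝒮 V) : CoordsIn 𝒮 (fun ω => U ω + V ω) :=
  fun a => 𝒮.add_mem (hU a) (hV a)

theorem sub (hU : CoordsIn 𝒮 U) (hV : CoordsIn 𝒮 V) : CoordsIn 𝒮 (fun ω => U ω - V ω) :=
  fun a => 𝒮.sub_mem (hU a) (hV a)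

theorem act (B : Matrix (Fin k) (Fin n) ℝ) (hU : CoordsIn 𝒮 U) :
    CoordsIn 𝒮 (fun ω => act B (U ω)) := fun a => by
  have h : (fun ω => LinearGaussian.act B (U ω) a) = ∑ b, B a b • fun ω => U ω b := by
    ext ω; simp [act_apply]
  rw [h]
  exact 𝒮.sum_mem fun b _ => 𝒮.smul_mem _ (hU b)

theorem const (h : (1 : Ω → ℝ) ∈ 𝒮) (x : Vec n) : CoordsIn 𝒮 (fun _ => x) := fun a => by
  have h' : (fun _ : Ω => x a) = x a • (1 : Ω → ℝ) := by ext; simp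
  rw [h']
  exact 𝒮.smul_mem _ h

theorem strongDual (hU : CoordsIn 𝒮 U) (L : StrongDual ℝ (Vec n)) :
    (fun ω => L (U ω)) ∈ 𝒮 := by
  have h : (fun ω => L (U ω)) = ∑ a, L (EuclideanSpace.basisFun (Fin n) ℝ a) • fun ω => U ω a := by
    ext ω
    conv_lhs => rw [← (EuclideanSpace.basisFun (Fin n) ℝ).sum_repr (U ω)]
    simp [mul_comm]
  rw [h]
  exact 𝒮.sum_mem fun a _ => 𝒮.smul_mem _ (hU a)

end CoordsIn

end Coordinates

/-! ### Second moment matrices and orthogonality. -/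

section Moments

variable {Ω : Type*} [MeasurableSpace Ω] {P : Measure Ω} {j k n : ℕ}

/-- The matrix of second moments `E[U Vᵀ]`. -/
noncomputable def moment (P : Measure Ω) (U : Ω → Vec k) (V : Ω → Vec n) :
    Matrix (Fin k) (Fin n) ℝ :=
  Matrix.of fun a b => ∫ ω, U ω a * V ω b ∂P

/-- The space of square integrable random variables. -/
def squareIntegrable (P : Measure Ω) : Submodule ℝ (Ω → ℝ) where
  carrier := {X | MemLp X 2 P}
  add_mem' := MemLp.add
  zero_mem' := MemLp.zero
  smul_mem' c _ h := h.const_smul c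

/-- The space of random variables orthogonal to all coordinates of the random vector `U`. -/
def orthSpace (P : Measure Ω) (U : Ω → Vec n) : Submodule ℝ (Ω → ℝ) where
  carrier := {X | ∀ a, Integrable (fun ω => U ω a * X ω) P ∧ ∫ ω, U ω a * X ω ∂P = 0}
  add_mem' {X Y} hX hY a := by
    simp only [Pi.add_apply, mul_add]
    exact ⟨(hX a).1.add (hY a).1, by rw [integral_add (hX a).1 (hY a).1, (hX a).2, (hY a).2,
      add_zero]⟩
  zero_mem' a := by simp
  smul_mem' c X hX a := by
    simp only [Pi.smul_apply, smul_eq_mul, mul_left_comm _ c]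
    exact ⟨(hX a).1.const_mul c, by rw [integral_const_mul, (hX a).2, mul_zero]⟩

theorem orthSpace_add_mem {U V : Ω → Vec n} {X : Ω → ℝ} (hU : X ∈ orthSpace P U)
    (hV : X ∈ orthSpace P V) : X ∈ orthSpace P (fun ω => U ω + V ω) := fun a => by
  simp only [PiLp.add_apply, add_mul]
  exact ⟨(hU a).1.add (hV a).1, by rw [integral_add (hU a).1 (hV a).1, (hU a).2, (hV a).2,
    add_zero]⟩

theorem orthSpace_sub_mem {U V : Ω → Vec n} {X : Ω → ℝ} (hU : X ∈ orthSpace P U)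
    (hV : X ∈ orthSpace P V) : X ∈ orthSpace P (fun ω => U ω - V ω) := fun a => by
  simp only [PiLp.sub_apply, sub_mul]
  exact ⟨(hU a).1.sub (hV a).1, by rw [integral_sub (hU a).1 (hV a).1, (hU a).2, (hV a).2,
    sub_zero]⟩

theorem orthSpace_act_mem (B : Matrix (Fin k) (Fin n) ℝ) {U : Ω → Vec n} {X : Ω → ℝ}
    (hU : X ∈ orthSpace P U) : X ∈ orthSpace P (fun ω => act B (U ω)) := fun a => by
  simp only [act_apply, Finset.sum_mul, mul_assoc]
  refine ⟨integrable_finsetSum _ fun b _ => (hU b).1.const_mul _, ?_⟩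
  rw [integral_finsetSum _ fun b _ => (hU b).1.const_mul _]
  exact Finset.sum_eq_zero fun b _ => by rw [integral_const_mul, (hU b).2, mul_zero]

namespace CoordsIn

variable {U : Ω → Vec n}

theorem memLp (hU : CoordsIn (squareIntegrable P) U) : MemLp U 2 P := MemLp.of_eval_piLp hU

theorem moment_eq_zero {V : Ω → Vec k} (h : CoordsIn (orthSpace P V) U) : moment P V U = 0 := by
  ext a b
  exact (h b a).2

end CoordsIn

theorem moment_transpose (U : Ω → Vec k) (V : Ω → Vec n) :
    (moment P U V).transpose = moment P V U := by
  ext a b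
  simp [moment, mul_comm]

theorem moment_eq_zero_comm {U : Ω → Vec k} {V : Ω → Vec n} (h : moment P U V = 0) :
    moment P V U = 0 := by
  rw [← moment_transpose, h, Matrix.transpose_zero]

theorem integrable_mul_coords {U : Ω → Vec k} {V : Ω → Vec n}
    (hU : CoordsIn (squareIntegrable P) U) (hV : CoordsIn (squareIntegrable P) V) (a b) :
    Integrable (fun ω => U ω a * V ω b) P :=
  MemLp.integrable_mul (hU a) (hV b)

theorem coordsIn_orthSpace_iff {U : Ω → Vec k} {V : Ω → Vec n}
    (hU : CoordsIn (squareIntegrable P) U) (hV : CoordsIn (squareIntegrable P) V) :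
    CoordsIn (orthSpace P U) V ↔ moment P U V = 0 :=
  ⟨fun h => h.moment_eq_zero, fun h b a =>
    ⟨integrable_mul_coords hU hV a b, congrFun (congrFun h a) b⟩⟩

theorem moment_add_left {U U' : Ω → Vec k} {V : Ω → Vec n}
    (hU : CoordsIn (squareIntegrable P) U) (hU' : CoordsIn (squareIntegrable P) U')
    (hV : CoordsIn (squareIntegrable P) V) :
    moment P (fun ω => U ω + U' ω) V = moment P U V + moment P U' V := by
  ext a b
  simp only [moment, Matrix.of_apply, Matrix.add_apply, PiLp.add_apply, add_mul]
  exact integral_add (integrable_mul_coords hU hV a b) (integrable_mul_coords hU' hV a b)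

theorem moment_sub_left {U U' : Ω → Vec k} {V : Ω → Vec n}
    (hU : CoordsIn (squareIntegrable P) U) (hU' : CoordsIn (squareIntegrable P) U')
    (hV : CoordsIn (squareIntegrable P) V) :
    moment P (fun ω => U ω - U' ω) V = moment P U V - moment P U' V := by
  ext a b
  simp only [moment, Matrix.of_apply, Matrix.sub_apply, PiLp.sub_apply, sub_mul]
  exact integral_sub (integrable_mul_coords hU hV a b) (integrable_mul_coords hU' hV a b)

theorem moment_act_left (B : Matrix (Fin j) (Fin k) ℝ) {U : Ω → Vec k} {V : Ω → Vec n}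
    (hU : CoordsIn (squareIntegrable P) U) (hV : CoordsIn (squareIntegrable P) V) :
    moment P (fun ω => act B (U ω)) V = B * moment P U V := by
  ext a b
  simp only [moment, Matrix.of_apply, Matrix.mul_apply, act_apply, Finset.sum_mul, mul_assoc]
  rw [integral_finsetSum _ fun c _ => (integrable_mul_coords hU hV c b).const_mul _]
  exact Finset.sum_congr rfl fun c _ => integral_const_mul _ _

theorem moment_add_right {U : Ω → Vec k} {V V' : Ω → Vec n}
    (hU : CoordsIn (squareIntegrable P) U) (hV : CoordsIn (squareIntegrable P) V)
    (hV' : CoordsIn (squareIntegrable P) V') :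
    moment P U (fun ω => V ω + V' ω) = moment P U V + moment P U V' := by
  rw [← moment_transpose, moment_add_left hV hV' hU, Matrix.transpose_add, moment_transpose,
    moment_transpose]

theorem moment_sub_right {U : Ω → Vec k} {V V' : Ω → Vec n}
    (hU : CoordsIn (squareIntegrable P) U) (hV : CoordsIn (squareIntegrable P) V)
    (hV' : CoordsIn (squareIntegrable P) V') :
    moment P U (fun ω => V ω - V' ω) = moment P U V - moment P U V' := by
  rw [← moment_transpose, moment_sub_left hV hV' hU, Matrix.transpose_sub, moment_transpose,
    moment_transpose]

theorem moment_act_right (B : Matrix (Fin j) (Fin n) ℝ) {U : Ω → Vec k} {V : Ω → Vec n}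
    (hU : CoordsIn (squareIntegrable P) U) (hV : CoordsIn (squareIntegrable P) V) :
    moment P U (fun ω => act B (V ω)) = moment P U V * B.transpose := by
  rw [← moment_transpose, moment_act_left B hV hU, Matrix.transpose_mul, moment_transpose]

theorem moment_posSemidef {U : Ω → Vec n} (hU : CoordsIn (squareIntegrable P) U) :
    (moment P U U).PosSemidef := by
  refine Matrix.PosSemidef.of_dotProduct_mulVec_nonneg (moment_transpose U U) fun x => ?_
  -- As a one-row matrix, `x` turns the quadratic form into the second moment of the scalar `B U`.
  set B : Matrix (Fin 1) (Fin n) ℝ := Matrix.of fun _ b => x b with hB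
  have h := (moment_act_left B hU (hU.act B)).trans
    (congrArg (B * ·) (moment_act_right B hU hU))
  have h0 : star x ⬝ᵥ (moment P U U).mulVec x = (B * (moment P U U * B.transpose)) 0 0 := by
    simp [Matrix.mul_apply, dotProduct, Matrix.mulVec, hB]
  rw [h0, ← h]
  exact integral_nonneg fun ω => mul_self_nonneg _

/-- Adding up the variances of two orthogonal random vectors. -/
theorem moment_add_self_of_orth {U V : Ω → Vec n} (hU : CoordsIn (squareIntegrable P) U)
    (hV : CoordsIn (squareIntegrable P) V) (h : moment P U V = 0) :
    moment P (fun ω => U ω + V ω) (fun ω => U ω + V ω) = moment P U U + moment P V V := by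
  rw [moment_add_left hU hV (hU.add hV), moment_add_right hU hU hV, moment_add_right hV hU hV, h,
    moment_eq_zero_comm h, add_zero, zero_add]

theorem integral_norm_sq_eq_trace {U : Ω → Vec n} (hU : CoordsIn (squareIntegrable P) U) :
    ∫ ω, ‖U ω‖ ^ 2 ∂P = (moment P U U).trace := by
  simp only [EuclideanSpace.real_norm_sq_eq, Matrix.trace, Matrix.diag, moment, Matrix.of_apply]
  rw [integral_finsetSum]
  · simp only [sq]
  · intro a _
    simpa only [sq] using integrable_mul_coords hU hU a a

end Moments

/-! ### Linear update with the optimal gain. -/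

section LinearUpdate

variable {k n : ℕ} {S : Matrix (Fin n) (Fin n) ℝ} {R : Matrix (Fin k) (Fin k) ℝ}
  {B : Matrix (Fin k) (Fin n) ℝ}

theorem posSemidef_mul_mul_transpose (hS : S.PosSemidef) (B : Matrix (Fin k) (Fin n) ℝ) :
    (B * S * B.transpose).PosSemidef := by
  rw [← Matrix.conjTranspose_eq_transpose_of_trivial]
  exact hS.mul_mul_conjTranspose_same B

theorem posDef_add_mul_mul_transpose (hS : S.PosDef) (hR : R.PosDef) :
    (R + B * S * B.transpose).PosDef :=
  hR.add_posSemidef (posSemidef_mul_mul_transpose hS.posSemidef B)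

/-- The covariance after a linear update with the optimal gain is positive definite. -/
theorem posDef_sub_gain_mul {K : Matrix (Fin n) (Fin k) ℝ} (hS : S.PosDef) (hR : R.PosDef)
    (hK : K * (R + B * S * B.transpose) = S * B.transpose) : (S - K * B * S).PosDef := by
  -- The Joseph form exhibits the updated covariance as a sum of two positive semidefinite matrices.
  have joseph : S - K * B * S =
      (1 - K * B) * S * (1 - K * B).transpose + K * R * K.transpose := by
    have e1 : (1 - K * B) * S * (1 - K * B).transpose + K * R * K.transpose =
        S - K * B * S - S * B.transpose * K.transpose +
          K * (R + B * S * B.transpose) * K.transpose := by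
      simp only [Matrix.transpose_sub, Matrix.transpose_one, Matrix.transpose_mul, Matrix.sub_mul,
        Matrix.mul_sub, Matrix.one_mul, Matrix.mul_one, Matrix.add_mul, Matrix.mul_add,
        ← Matrix.mul_assoc]
      abel
    rw [e1, hK]
    abel
  rw [joseph]
  have h1 := posSemidef_mul_mul_transpose hS.posSemidef (1 - K * B)
  have h2 := posSemidef_mul_mul_transpose hR.posSemidef K
  refine Matrix.PosDef.of_dotProduct_mulVec_pos (h1.add h2).isHermitian fun x hx => ?_
  have hquad : ∀ {l : ℕ} (C : Matrix (Fin n) (Fin l) ℝ) (D : Matrix (Fin l) (Fin l) ℝ),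
      star x ⬝ᵥ (C * D * C.transpose).mulVec x =
        star (C.transpose.mulVec x) ⬝ᵥ D.mulVec (C.transpose.mulVec x) := by
    intro l C D
    rw [← Matrix.mulVec_mulVec, ← Matrix.mulVec_mulVec, Matrix.dotProduct_mulVec,
      Matrix.mulVec_transpose]
    simp only [star_trivial]
  rw [Matrix.add_mulVec, dotProduct_add]
  -- If `Kᵀ x = 0` then `(1 - K B)ᵀ x = x` and the term with `S` is positive; otherwise the term
  -- with `R` is.
  by_cases hKx : K.transpose.mulVec x = 0
  · have h3 : (1 - K * B).transpose.mulVec x = x := by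
      rw [Matrix.transpose_sub, Matrix.transpose_mul, Matrix.sub_mulVec, ← Matrix.mulVec_mulVec,
        hKx]
      simp
    rw [hquad, h3]
    exact add_pos_of_pos_of_nonneg (hS.dotProduct_mulVec_pos hx) (h2.dotProduct_mulVec_nonneg x)
  · rw [hquad K R]
    exact add_pos_of_nonneg_of_pos (h1.dotProduct_mulVec_nonneg x) (hR.dotProduct_mulVec_pos hKx)

variable {Ω : Type*} [MeasurableSpace Ω] {P : Measure Ω} {e : Ω → Vec n} {z : Ω → Vec k}
  {K : Matrix (Fin n) (Fin k) ℝ}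

/-- The residual of a linear update with the optimal gain is orthogonal to the innovation. -/
theorem moment_update_innovation (he : CoordsIn (squareIntegrable P) e)
    (hz : CoordsIn (squareIntegrable P) z) (hee : moment P e e = S) (hzz : moment P z z = R)
    (hez : moment P e z = 0) (hK : K * (R + B * S * B.transpose) = S * B.transpose) :
    moment P (fun ω => e ω - act K (act B (e ω) + z ω)) (fun ω => act B (e ω) + z ω) = 0 := by
  have hBe := he.act B
  have hi := hBe.add hz
  rw [moment_sub_left he (hi.act K) hi, moment_act_left K hi hi, moment_add_right he hBe hz,
    moment_add_left hBe hz hi, moment_add_right hBe hBe hz, moment_add_right hz hBe hz,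
    moment_act_right B hBe he, moment_act_right B he he, moment_act_right B hz he,
    moment_act_left B he he, moment_act_left B he hz, hee, hzz, hez, moment_eq_zero_comm hez]
  rw [← hK]
  simp [add_comm]

/-- The residual is orthogonal to the innovation, so its moment with itself equals its moment with
`e`. -/
theorem moment_update_self (he : CoordsIn (squareIntegrable P) e)
    (hz : CoordsIn (squareIntegrable P) z) (hee : moment P e e = S) (hzz : moment P z z = R)
    (hez : moment P e z = 0) (hK : K * (R + B * S * B.transpose) = S * B.transpose) :
    moment P (fun ω => e ω - act K (act B (e ω) + z ω))
      (fun ω => e ω - act K (act B (e ω) + z ω)) = S - K * B * S := by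
  have hBe := he.act B
  have hi := hBe.add hz
  have hr := he.sub (hi.act K)
  rw [moment_sub_right hr he (hi.act K), moment_act_right K hr hi,
    moment_update_innovation he hz hee hzz hez hK, Matrix.zero_mul, sub_zero,
    moment_sub_left he (hi.act K) he, moment_act_left K hi he, moment_add_left hBe hz he,
    moment_act_left B he he, hee, moment_eq_zero_comm hez, add_zero, Matrix.mul_assoc]

end LinearUpdate

/-! ### Affine spans of families of random vectors. -/

section AffineSpan

variable {Ω ι : Type*} {dim : ι → ℕ} (ξ : (k : ι) → Ω → Vec (dim k))

/-- The space spanned by the constants and the coordinates of the random vectors `ξ k`, `k ∈ T`. -/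
def affineSpanOf (T : Set ι) : Submodule ℝ (Ω → ℝ) :=
  Submodule.span ℝ (insert 1 {X | ∃ k ∈ T, ∃ a, X = fun ω => ξ k ω a})

variable {ξ}

theorem one_mem_affineSpanOf (T : Set ι) : (1 : Ω → ℝ) ∈ affineSpanOf ξ T :=
  Submodule.subset_span (Set.mem_insert _ _)

theorem coordsIn_affineSpanOf {T : Set ι} {k : ι} (hk : k ∈ T) :
    CoordsIn (affineSpanOf ξ T) (ξ k) :=
  fun a => Submodule.subset_span (Set.mem_insert_of_mem _ ⟨k, hk, a, rfl⟩)

theorem affineSpanOf_le {T : Set ι} {𝒮 : Submodule ℝ (Ω → ℝ)} (h1 : (1 : Ω → ℝ) ∈ 𝒮)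
    (h : ∀ k ∈ T, CoordsIn 𝒮 (ξ k)) : affineSpanOf ξ T ≤ 𝒮 := by
  refine Submodule.span_le.2 ?_
  rintro _ (rfl | ⟨k, hk, a, rfl⟩)
  · exact h1
  · exact h k hk a

theorem affineSpanOf_mono {T T' : Set ι} (h : T ⊆ T') : affineSpanOf ξ T ≤ affineSpanOf ξ T' :=
  affineSpanOf_le (one_mem_affineSpanOf _) fun _ hk => coordsIn_affineSpanOf (h hk)

end AffineSpan

/-! ### Gaussian spaces: orthogonality implies independence. -/

section GaussianFamily

variable {Ω ι : Type*} [MeasurableSpace Ω] {P : Measure Ω}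
  {dim : ι → ℕ} {ξ : (k : ι) → Ω → Vec (dim k)}

theorem isGaussianProcess_coords (hξ : ∀ k, HasGaussianLaw (ξ k) P) (hind : iIndepFun ξ P) :
    IsGaussianProcess (fun (q : Σ k, Fin (dim k)) ω => ξ q.1 ω q.2) P where
  hasGaussianLaw I := by
    classical
    set K : Finset ι := I.image Sigma.fst
    have hK : iIndepFun (fun (k : K) => ξ k) P := hind.precomp Subtype.val_injective
    have h := iIndepFun.hasGaussianLaw (fun k : K => hξ k) hK
    let L : ((k : K) → Vec (dim k)) →L[ℝ] (I → ℝ) := ContinuousLinearMap.pi fun q : I =>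
      (EuclideanSpace.proj q.1.2 : Vec (dim q.1.1) →L[ℝ] ℝ) ∘L
        (ContinuousLinearMap.proj (⟨q.1.1, Finset.mem_image_of_mem _ q.2⟩ : K) :
          ((k : K) → Vec (dim k)) →L[ℝ] Vec (dim q.1.1))
    exact h.map L

/-- Affine combinations of independent Gaussian random vectors are Gaussian. -/
theorem hasGaussianLaw_of_mem_affineSpanOf (hξ : ∀ k, HasGaussianLaw (ξ k) P)
    (hind : iIndepFun ξ P) {T : Set ι} {X : Ω → ℝ} (hX : X ∈ affineSpanOf ξ T) :
    HasGaussianLaw X P := by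
  obtain ⟨c, z, hz, rfl⟩ := Submodule.mem_span_insert.1 hX
  have hz' : z ∈ Submodule.span ℝ
      (Set.range fun (q : Σ k, Fin (dim k)) ω => ξ q.1 ω q.2) := by
    refine Submodule.span_mono ?_ hz
    rintro _ ⟨k, -, a, rfl⟩
    exact ⟨⟨k, a⟩, rfl⟩
  obtain ⟨f, rfl⟩ := Finsupp.mem_span_range_iff_exists_finsupp.1 hz'
  have h := ((isGaussianProcess_coords hξ hind).smul f).hasGaussianLaw_sum (I := f.support)
  set z : Ω → ℝ := f.sum fun i a => a • fun ω => ξ i.1 ω i.2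
  have hz2 : HasGaussianLaw z P := h
  have : c • (1 : Ω → ℝ) + z = (fun x => c + x) ∘ z := by ext; simp
  have hg := hz2.isGaussian_map
  rw [this]
  refine ⟨?_⟩
  rw [← AEMeasurable.map_map_of_aemeasurable (by fun_prop) hz2.aemeasurable]
  infer_instance

theorem affineSpanOf_le_squareIntegrable (hξ : ∀ k, HasGaussianLaw (ξ k) P)
    (hind : iIndepFun ξ P) (T : Set ι) : affineSpanOf ξ T ≤ squareIntegrable P :=
  fun _ hX => (hasGaussianLaw_of_mem_affineSpanOf hξ hind hX).memLp_two

variable [IsProbabilityMeasure P]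

/-- A centered member of an independent family is orthogonal to the span of the other members. -/
theorem affineSpanOf_le_orthSpace (hξ : ∀ k, HasGaussianLaw (ξ k) P) (hind : iIndepFun ξ P)
    {T : Set ι} {k : ι} (hk : k ∉ T) (hmean : ∀ a, ∫ ω, ξ k ω a ∂P = 0) :
    affineSpanOf ξ T ≤ orthSpace P (ξ k) := by
  have hcoord : ∀ j (a : Fin (dim j)), MemLp (fun ω => ξ j ω a) 2 P := fun j a =>
    affineSpanOf_le_squareIntegrable hξ hind Set.univ (coordsIn_affineSpanOf (Set.mem_univ j) a)
  refine affineSpanOf_le (fun a => ?_) fun j hj b a => ?_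
  · simp only [Pi.one_apply, mul_one]
    exact ⟨(hcoord k a).integrable one_le_two, hmean a⟩
  · have hne : k ≠ j := fun h => hk (h ▸ hj)
    have hi : IndepFun (fun ω => ξ k ω a) (fun ω => ξ j ω b) P :=
      (hind.indepFun hne).comp (φ := fun x : Vec (dim k) => x a)
        (ψ := fun x : Vec (dim j) => x b) (by fun_prop) (by fun_prop)
    refine ⟨MemLp.integrable_mul (hcoord k a) (hcoord j b), ?_⟩
    rw [hi.integral_fun_mul_eq_mul_integral (hcoord k a).aestronglyMeasurable
      (hcoord j b).aestronglyMeasurable, hmean, zero_mul]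

variable {n m t : ℕ} {e : Ω → Vec n}

/-- A centered random vector with coordinates in a Gaussian space is Gaussian. -/
theorem map_eq_multivariateGaussian (hξ : ∀ k, HasGaussianLaw (ξ k) P) (hind : iIndepFun ξ P)
    {T : Set ι} (he : CoordsIn (affineSpanOf ξ T) e) (hmean : (1 : Ω → ℝ) ∈ orthSpace P e) :
    P.map e = multivariateGaussian 0 (moment P e e) := by
  have hL2 := affineSpanOf_le_squareIntegrable hξ hind T
  have hS := moment_posSemidef (he.mono hL2)
  have hem : AEMeasurable e P := (he.mono hL2).memLp.aestronglyMeasurable.aemeasurable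
  -- Orthogonality to the constant `1` is how centering is encoded.
  have h0 : ∀ a, ∫ ω, e ω a ∂P = 0 := fun a => by simpa using (hmean a).2
  have : IsGaussian (P.map e) := isGaussian_of_isGaussian_map fun L => by
    rw [AEMeasurable.map_map_of_aemeasurable (by fun_prop) hem]
    exact (hasGaussianLaw_of_mem_affineSpanOf hξ hind (he.strongDual L)).isGaussian_map
  refine IsGaussian.ext ?_ ?_
  · have hint : Integrable e P := (he.mono hL2).memLp.integrable one_le_two
    simp only [id_eq, integral_id_multivariateGaussian]
    rw [show ∫ x, x ∂(P.map e) = ∫ ω, e ω ∂P from integral_map hem aestronglyMeasurable_id]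
    ext a
    rw [PiLp.zero_apply, ← h0 a]
    exact ((EuclideanSpace.proj a : Vec n →L[ℝ] ℝ).integral_comp_comm hint).symm
  · rw [← ContinuousLinearMap.toBilinForm_inj]
    refine LinearMap.BilinForm.ext_basis (EuclideanSpace.basisFun (Fin n) ℝ).toBasis fun i j => ?_
    rw [ContinuousLinearMap.toBilinForm_apply, ContinuousLinearMap.toBilinForm_apply,
      covarianceBilin_multivariateGaussian hS, OrthonormalBasis.coe_toBasis]
    have h1 := covarianceBilin_apply_basisFun (X := fun a ω => e ω a) (fun a => hL2 (he a)) i j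
    refine h1.trans ?_
    rw [covariance_eq_sub (hL2 (he i)) (hL2 (he j)), h0, zero_mul, sub_zero]
    simp [moment]

/-- A centered random vector in a Gaussian space is independent of the random vectors in this
space that it is orthogonal to. -/
theorem indepFun_of_orthSpace (hξ : ∀ k, HasGaussianLaw (ξ k) P) (hind : iIndepFun ξ P)
    {T : Set ι} (he : CoordsIn (affineSpanOf ξ T) e) (hmean : (1 : Ω → ℝ) ∈ orthSpace P e)
    {y : Fin t → Ω → Vec m} (hy : ∀ k, CoordsIn (affineSpanOf ξ T) (y k))
    (hey : ∀ k, CoordsIn (orthSpace P e) (y k)) :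
    IndepFun (fun ω k => y k ω) e P := by
  have hL2 := affineSpanOf_le_squareIntegrable hξ hind T
  have hem : AEMeasurable e P := (he.mono hL2).memLp.aestronglyMeasurable.aemeasurable
  have hym : AEMeasurable (fun ω k => y k ω) P := aemeasurable_pi_lambda _ fun k =>
    ((hy k).mono hL2).memLp.aestronglyMeasurable.aemeasurable
  have hdual : ∀ {𝒮 : Submodule ℝ (Ω → ℝ)}, (∀ k, CoordsIn 𝒮 (y k)) →
      ∀ L : StrongDual ℝ (Fin t → Vec m), (fun ω => L fun k => y k ω) ∈ 𝒮 := by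
    intro 𝒮 h L
    have h1 : (fun ω => L fun k => y k ω) =
        ∑ k, fun ω => (L ∘L ContinuousLinearMap.single ℝ (fun _ : Fin t => Vec m) k) (y k ω) := by
      ext ω
      simp only [Finset.sum_apply, ContinuousLinearMap.comp_apply, ← map_sum]
      congr 1
      exact (LinearMap.sum_single_apply (fun _ : Fin t => Vec m) fun k => y k ω).symm
    rw [h1]
    exact 𝒮.sum_mem fun k _ => (h k).strongDual _
  -- Joint Gaussianity: every continuous functional of the pair lies in the affine span, hence is
  -- Gaussian.
  have hpair : HasGaussianLaw (fun ω => ((fun k => y k ω), e ω)) P := by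
    refine ⟨isGaussian_of_isGaussian_map fun L => ?_⟩
    rw [AEMeasurable.map_map_of_aemeasurable (by fun_prop) (hym.prodMk hem)]
    have hmem : (L ∘ fun ω => ((fun k => y k ω), e ω)) ∈ affineSpanOf ξ T := by
      have h1 : (L ∘ fun ω => ((fun k => y k ω), e ω)) =
          (fun ω => (L ∘L ContinuousLinearMap.inl ℝ (Fin t → Vec m) (Vec n)) fun k => y k ω) +
          fun ω => (L ∘L ContinuousLinearMap.inr ℝ (Fin t → Vec m) (Vec n)) (e ω) := by
        ext ω
        simp [← map_add]
      rw [h1]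
      exact Submodule.add_mem _ (hdual hy _) (he.strongDual _)
    exact (hasGaussianLaw_of_mem_affineSpanOf hξ hind hmem).isGaussian_map
  refine hpair.indepFun_of_covariance_strongDual fun L₁ L₂ => ?_
  have h1 : (L₁ ∘ fun ω k => y k ω) ∈ orthSpace P e := hdual hey L₁
  have h1' : (L₁ ∘ fun ω k => y k ω) ∈ squareIntegrable P := hL2 (hdual hy L₁)
  have h1'' : (L₂ ∘ e) ∈ squareIntegrable P := hL2 (he.strongDual L₂)
  -- Orthogonality is symmetric: with `X` viewed as a one-dimensional vector, `e` has coordinates in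
  -- its orthogonal space, and a functional `L₂` can then be applied to `e`.
  have h2 : ∀ {X : Ω → ℝ}, X ∈ orthSpace P e →
      CoordsIn (orthSpace P fun ω => WithLp.toLp 2 fun _ : Fin 1 => X ω) e :=
    fun {X} hX a _ => by simpa only [mul_comm] using hX a
  have h3 := (h2 h1).strongDual L₂ 0
  have h4 := (h2 hmean).strongDual L₂ 0
  rw [covariance_eq_sub h1' h1'']
  have h5 : ∫ ω, (L₂ ∘ e) ω ∂P = 0 := by simpa using h4.2
  have h6 : ∫ ω, ((L₁ ∘ fun ω k => y k ω) * (L₂ ∘ e)) ω ∂P = 0 := h3.2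
  rw [h5, h6]
  simp

end GaussianFamily

theorem measurable_act {k n : ℕ} (B : Matrix (Fin k) (Fin n) ℝ) : Measurable (act B) := by
  unfold act
  fun_prop

/-! ### Moments of vectors with a Gaussian law. -/

section Law

variable {Ω : Type*} [MeasurableSpace Ω] {P : Measure Ω} {n : ℕ}
  {U : Ω → Vec n} {μ : Vec n} {S : Matrix (Fin n) (Fin n) ℝ}

theorem integral_coord_of_hasLaw (h : HasLaw U (multivariateGaussian μ S) P) (a : Fin n) :
    ∫ ω, U ω a ∂P = μ a := by
  have h1 : ∫ ω, U ω a ∂P = ∫ x : Vec n, x a ∂(multivariateGaussian μ S) := by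
    rw [← h.map_eq]
    exact (integral_map (f := fun x : Vec n => x a) h.aemeasurable (by fun_prop)).symm
  have h2 := (EuclideanSpace.proj a : Vec n →L[ℝ] ℝ).integral_comp_comm
    (IsGaussian.integrable_id (μ := multivariateGaussian μ S))
  simp only [id_eq, integral_id_multivariateGaussian] at h2
  exact h1.trans h2

theorem moment_of_hasLaw (hS : S.PosSemidef) (h : HasLaw U (multivariateGaussian μ S) P) :
    moment P (fun ω => U ω - μ) (fun ω => U ω - μ) = S := by
  ext a b
  rw [← covariance_eval_multivariateGaussian (μ := μ) hS a b, ← h.map_eq,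
    covariance_map (by fun_prop) (by fun_prop) h.aemeasurable]
  simp [covariance, moment, integral_coord_of_hasLaw h]

end Law

/-! ### The model: which noises enter which variables. -/

/-- The sources of randomness that determine the states up to time `p` and the measurement noises
up to time `q`. -/
def sourcesUpTo (p q : ℕ) : Set Source := fun k =>
  match k with
  | .init => True
  | .trans n => n + 2 ≤ p
  | .meas n => n + 1 ≤ q

theorem sourcesUpTo_subset {p p' q q' : ℕ} (hp : p ≤ p') (hq : q ≤ q') :
    sourcesUpTo p q ⊆ sourcesUpTo p' q' := by
  rintro (_ | n | n) h
  · trivial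
  · exact le_trans (b := p) h hp
  · exact le_trans (b := q) h hq

theorem coordsIn_trans {Ω : Type*} {d m : ℕ} {i p : ℕ} (q : ℕ)
    (θ w : ℕ → Ω → Vec d) (v : ℕ → Ω → Vec m) (hi : 2 ≤ i) (hp : i ≤ p) :
    CoordsIn (affineSpanOf (sources θ w v) (sourcesUpTo p q)) (w i) := by
  obtain ⟨n, rfl⟩ := Nat.exists_eq_add_of_le' hi
  exact coordsIn_affineSpanOf (ξ := sources θ w v) (k := .trans n) hp

theorem coordsIn_meas {Ω : Type*} {d m : ℕ} {i q : ℕ} (p : ℕ)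
    (θ w : ℕ → Ω → Vec d) (v : ℕ → Ω → Vec m) (hi : 1 ≤ i) (hq : i ≤ q) :
    CoordsIn (affineSpanOf (sources θ w v) (sourcesUpTo p q)) (v i) := by
  obtain ⟨n, rfl⟩ := Nat.exists_eq_add_of_le' hi
  exact coordsIn_affineSpanOf (ξ := sources θ w v) (k := .meas n) hq

/-- The space spanned by the constants and the coordinates of `y 1, …, y t`. -/
def obsSpace {Ω : Type*} {m : ℕ} (y : ℕ → Ω → Vec m) (t : ℕ) : Submodule ℝ (Ω → ℝ) :=
  affineSpanOf (dim := fun _ => m) y (Set.Icc 1 t)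

theorem obsSpace_mono {Ω : Type*} {m : ℕ} (y : ℕ → Ω → Vec m) {s t : ℕ} (h : s ≤ t) :
    obsSpace y s ≤ obsSpace y t :=
  affineSpanOf_mono (Set.Icc_subset_Icc_right h)

theorem one_mem_obsSpace {Ω : Type*} {m : ℕ} (y : ℕ → Ω → Vec m) (t : ℕ) :
    (1 : Ω → ℝ) ∈ obsSpace y t :=
  one_mem_affineSpanOf _

/-- `est` has coordinates in `𝒴`, and its error as an estimate of `Z` is orthogonal to `𝒴`, with
positive definite covariance matrix `S`. -/
structure IsLinearEstimate {Ω : Type*} [MeasurableSpace Ω] (P : Measure Ω) {n : ℕ}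
    (𝒴 : Submodule ℝ (Ω → ℝ)) (Z est : Ω → Vec n) (S : Matrix (Fin n) (Fin n) ℝ) : Prop where
  coordsIn : CoordsIn 𝒴 est
  orth : 𝒴 ≤ orthSpace P (fun ω => Z ω - est ω)
  moment_eq : moment P (fun ω => Z ω - est ω) (fun ω => Z ω - est ω) = S
  posDef : S.PosDef

namespace IsLGM

variable {Ω : Type*} [MeasurableSpace Ω] {P : Measure Ω} {d m : ℕ} {M : Params d m}
  {θ : ℕ → Ω → Vec d} {y : ℕ → Ω → Vec m} {w : ℕ → Ω → Vec d} {v : ℕ → Ω → Vec m}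
  (hM : IsLGM P M θ y w v)

include hM

theorem hasGaussianLaw_sources (k : Source) : HasGaussianLaw (sources θ w v k) P :=
  match k with
  | .init => hM.law_init.hasGaussianLaw
  | .trans n => (hM.law_trans (n + 2) (by omega)).hasGaussianLaw
  | .meas n => (hM.law_meas (n + 1) (by omega)).hasGaussianLaw

theorem measurable_trans {i : ℕ} (hi : 2 ≤ i) : Measurable (w i) := by
  obtain ⟨n, rfl⟩ := Nat.exists_eq_add_of_le' hi
  exact hM.measurable_sources (.trans n)

theorem measurable_meas {i : ℕ} (hi : 1 ≤ i) : Measurable (v i) := by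
  obtain ⟨n, rfl⟩ := Nat.exists_eq_add_of_le' hi
  exact hM.measurable_sources (.meas n)

theorem state_succ {i : ℕ} (hi : 1 ≤ i) :
    θ (i + 1) = fun ω => act (M.A (i + 1)) (θ i ω) + w (i + 1) ω :=
  funext fun ω => hM.state_eq (i + 1) (by omega) ω

theorem obs_eq {i : ℕ} (hi : 1 ≤ i) :
    y i = fun ω => act (M.X i).transpose (θ i ω) + v i ω :=
  funext fun ω => hM.meas_eq i hi ω

theorem measurable_state {i : ℕ} (hi : 1 ≤ i) : Measurable (θ i) := by
  induction i, hi using Nat.le_induction with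
  | base => exact hM.measurable_sources .init
  | succ i hi ih =>
    rw [hM.state_succ hi]
    exact ((measurable_act _).comp ih).add (hM.measurable_trans (by omega))

theorem measurable_obs_apply {i : ℕ} (hi : 1 ≤ i) : Measurable (y i) := by
  rw [hM.obs_eq hi]
  exact ((measurable_act _).comp (hM.measurable_state hi)).add (hM.measurable_meas hi)

theorem coordsIn_state {i p : ℕ} (q : ℕ) (hi : 1 ≤ i) (hp : i ≤ p) :
    CoordsIn (affineSpanOf (sources θ w v) (sourcesUpTo p q)) (θ i) := by
  induction i, hi using Nat.le_induction with
  | base => exact coordsIn_affineSpanOf (ξ := sources θ w v) (k := .init) trivial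
  | succ i hi ih =>
    rw [hM.state_succ hi]
    exact ((ih (by omega)).act _).add (coordsIn_trans q θ w v (by omega) hp)

theorem coordsIn_obs {i p q : ℕ} (hi : 1 ≤ i) (hp : i ≤ p) (hq : i ≤ q) :
    CoordsIn (affineSpanOf (sources θ w v) (sourcesUpTo p q)) (y i) := by
  rw [hM.obs_eq hi]
  exact ((hM.coordsIn_state q hi hp).act _).add (coordsIn_meas p θ w v hi hq)

theorem obsSpace_le {t p q : ℕ} (hp : t ≤ p) (hq : t ≤ q) :
    obsSpace y t ≤ affineSpanOf (sources θ w v) (sourcesUpTo p q) :=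
  affineSpanOf_le (one_mem_affineSpanOf _) fun _ hk =>
    hM.coordsIn_obs hk.1 (hk.2.trans hp) (hk.2.trans hq)

theorem moment_trans {i : ℕ} (hi : 2 ≤ i) : moment P (w i) (w i) = M.Q i := by
  simpa using moment_of_hasLaw (M.Q_posDef i hi).posSemidef (hM.law_trans i hi)

theorem moment_meas {i : ℕ} (hi : 1 ≤ i) : moment P (v i) (v i) = M.R i := by
  simpa using moment_of_hasLaw (M.R_posDef i hi).posSemidef (hM.law_meas i hi)

theorem le_squareIntegrable (T : Set Source) :
    affineSpanOf (sources θ w v) T ≤ squareIntegrable P :=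
  affineSpanOf_le_squareIntegrable hM.hasGaussianLaw_sources hM.indep T

theorem trans_mem_squareIntegrable {i : ℕ} (hi : 2 ≤ i) : CoordsIn (squareIntegrable P) (w i) :=
  (coordsIn_trans 0 θ w v hi le_rfl).mono (hM.le_squareIntegrable _)

theorem meas_mem_squareIntegrable {i : ℕ} (hi : 1 ≤ i) : CoordsIn (squareIntegrable P) (v i) :=
  (coordsIn_meas 0 θ w v hi le_rfl).mono (hM.le_squareIntegrable _)

theorem state_mem_squareIntegrable {i : ℕ} (hi : 1 ≤ i) : CoordsIn (squareIntegrable P) (θ i) :=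
  (hM.coordsIn_state 0 hi le_rfl).mono (hM.le_squareIntegrable _)

theorem obsSpace_le_squareIntegrable (t : ℕ) : obsSpace y t ≤ squareIntegrable P :=
  (hM.obsSpace_le le_rfl le_rfl).trans (hM.le_squareIntegrable _)

variable [IsProbabilityMeasure P]

theorem le_orthSpace_trans {i p : ℕ} (q : ℕ) (hi : 2 ≤ i) (hp : p < i) :
    affineSpanOf (sources θ w v) (sourcesUpTo p q) ≤ orthSpace P (w i) := by
  have hmean := integral_coord_of_hasLaw (hM.law_trans i hi)
  obtain ⟨n, rfl⟩ := Nat.exists_eq_add_of_le' hi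
  exact affineSpanOf_le_orthSpace hM.hasGaussianLaw_sources hM.indep (k := .trans n)
    (fun h => absurd (show n + 2 ≤ p from h) (by omega)) hmean

theorem le_orthSpace_meas {i q : ℕ} (p : ℕ) (hi : 1 ≤ i) (hq : q < i) :
    affineSpanOf (sources θ w v) (sourcesUpTo p q) ≤ orthSpace P (v i) := by
  have hmean := integral_coord_of_hasLaw (hM.law_meas i hi)
  obtain ⟨n, rfl⟩ := Nat.exists_eq_add_of_le' hi
  exact affineSpanOf_le_orthSpace hM.hasGaussianLaw_sources hM.indep (k := .meas n)
    (fun h => absurd (show n + 1 ≤ q from h) (by omega)) hmean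

/-! ### The Kalman filter. -/

theorem isLinearEstimate_init : IsLinearEstimate P (obsSpace y 0) (θ 1)
    (fun ω => M.predMean (fun k => y k ω) 1) (M.predCov 1) where
  coordsIn := CoordsIn.const (one_mem_obsSpace y 0) M.mean₁
  orth := by
    -- `Set.Icc 1 0` is empty: only the constants remain, and orthogonality to them is the mean of
    -- `θ 1`.
    refine affineSpanOf_le (fun a => ?_) fun k hk => absurd (hk.1.trans hk.2) (by omega)
    have hint : Integrable (fun ω => θ 1 ω a) P :=
      (hM.state_mem_squareIntegrable le_rfl a).integrable one_le_two
    simp only [Params.predMean, PiLp.sub_apply, Pi.one_apply, mul_one]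
    refine ⟨hint.sub (integrable_const _), ?_⟩
    rw [integral_sub hint (integrable_const _), integral_coord_of_hasLaw hM.law_init]
    simp
  moment_eq := moment_of_hasLaw M.cov₁_posDef.posSemidef hM.law_init
  posDef := M.cov₁_posDef

omit hM [IsProbabilityMeasure P] in
theorem gain_mul_eq {k n : ℕ} {S : Matrix (Fin n) (Fin n) ℝ} {R : Matrix (Fin k) (Fin k) ℝ}
    {B : Matrix (Fin k) (Fin n) ℝ} (hS : S.PosDef) (hR : R.PosDef) :
    S * B.transpose * (R + B * S * B.transpose)⁻¹ * (R + B * S * B.transpose) =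
      S * B.transpose := by
  rw [Matrix.mul_assoc, Matrix.nonsing_inv_mul _
    ((Matrix.isUnit_iff_isUnit_det _).1 (posDef_add_mul_mul_transpose hS hR).isUnit),
    Matrix.mul_one]

/-- The new error is `r = e - K (Xᵀ e + v)`. It is orthogonal to the past observations because `e`
and `v` are, and to the innovation by the gain equation. The new observation is the innovation plus
`Xᵀ` times the prediction, so `r` is orthogonal to it too. -/
theorem isLinearEstimate_correct {t : ℕ}
    (h : IsLinearEstimate P (obsSpace y t) (θ (t + 1))
      (fun ω => M.predMean (fun k => y k ω) (t + 1)) (M.predCov (t + 1))) :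
    IsLinearEstimate P (obsSpace y (t + 1)) (θ (t + 1))
      (fun ω => M.filtMean (fun k => y k ω) (t + 1)) (M.filtCov (t + 1)) := by
  have ht : 1 ≤ t + 1 := by omega
  set S := M.predCov (t + 1)
  set est : Ω → Vec d := fun ω => M.predMean (fun k => y k ω) (t + 1)
  set e : Ω → Vec d := fun ω => θ (t + 1) ω - est ω with he
  set B := (M.X (t + 1)).transpose
  set K := M.gain (t + 1) S
  set r : Ω → Vec d := fun ω => e ω - act K (act B (e ω) + v (t + 1) ω) with hr
  have hK : K * (M.R (t + 1) + B * S * B.transpose) = S * B.transpose :=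
    gain_mul_eq (B := B) h.posDef (M.R_posDef _ ht)
  have herr : (fun ω => θ (t + 1) ω - M.filtMean (fun k => y k ω) (t + 1)) = r := by
    ext1 ω
    have h1 : M.filtMean (fun k => y k ω) (t + 1) =
        est ω - act K (act B (est ω) - y (t + 1) ω) := rfl
    have h2 : act B (est ω) - y (t + 1) ω = -(act B (e ω) + v (t + 1) ω) := by
      rw [hM.meas_eq _ ht ω, he, act_sub]
      abel
    have h3 : ∀ x : Vec m, act K (-x) = -act K x := fun x => by
      rw [← zero_sub, act_sub, ← zero_sub (act K x)]
      congr 1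
      ext a
      simp [act_apply]
    rw [h1, h2, h3, sub_neg_eq_add, ← sub_sub]
  have heL2 : CoordsIn (squareIntegrable P) e := (hM.state_mem_squareIntegrable ht).sub
    (h.coordsIn.mono (hM.obsSpace_le_squareIntegrable t))
  have hvL2 := hM.meas_mem_squareIntegrable ht
  have hpast : CoordsIn (affineSpanOf (sources θ w v) (sourcesUpTo (t + 1) t)) e :=
    (hM.coordsIn_state t ht le_rfl).sub (h.coordsIn.mono (hM.obsSpace_le (by omega) le_rfl))
  have hev : moment P e (v (t + 1)) = 0 := moment_eq_zero_comm
    (hpast.mono (hM.le_orthSpace_meas (t + 1) ht (by omega))).moment_eq_zero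
  have hinn := moment_update_innovation heL2 hvL2 h.moment_eq (hM.moment_meas ht) hev hK
  have hcov := moment_update_self heL2 hvL2 h.moment_eq (hM.moment_meas ht) hev hK
  have hiL2 := (heL2.act B).add hvL2
  have hrL2 : CoordsIn (squareIntegrable P) r := heL2.sub (hiL2.act K)
  have horth : obsSpace y t ≤ orthSpace P r := fun X hX =>
    orthSpace_sub_mem (h.orth hX) (orthSpace_act_mem K (orthSpace_add_mem
      (orthSpace_act_mem B (h.orth hX))
      (hM.le_orthSpace_meas t ht (by omega) (hM.obsSpace_le le_rfl le_rfl hX))))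
  have hpredY : CoordsIn (obsSpace y (t + 1)) est := h.coordsIn.mono (obsSpace_mono y (by omega))
  have hy : CoordsIn (obsSpace y (t + 1)) (y (t + 1)) :=
    coordsIn_affineSpanOf (ξ := y) (dim := fun _ => m) ⟨ht, le_rfl⟩
  refine ⟨hpredY.sub (((hpredY.act B).sub hy).act K), ?_, ?_, ?_⟩
  · rw [herr]
    refine affineSpanOf_le (horth (one_mem_obsSpace y t)) fun k hk => ?_
    rcases Nat.lt_or_ge t k with hlt | hle
    · obtain rfl : k = t + 1 := le_antisymm hk.2 hlt
      have hyk : y (t + 1) = fun ω => (act B (e ω) + v (t + 1) ω) + act B (est ω) := by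
        ext1 ω
        rw [hM.meas_eq _ ht ω, he, act_sub]
        abel
      rw [hyk]
      exact ((coordsIn_orthSpace_iff hrL2 hiL2).2 hinn).add ((h.coordsIn.mono horth).act B)
    · exact (coordsIn_affineSpanOf (ξ := y) (dim := fun _ => m) (T := Set.Icc 1 t)
        ⟨hk.1, hle⟩).mono horth
  · rw [herr]
    exact hcov
  · exact posDef_sub_gain_mul h.posDef (M.R_posDef _ ht) hK

omit [IsProbabilityMeasure P] in
theorem predErr_eq {t : ℕ} : (fun ω => θ (t + 2) ω - M.predMean (fun k => y k ω) (t + 2)) =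
    fun ω => act (M.A (t + 2)) (θ (t + 1) ω - M.filtMean (fun k => y k ω) (t + 1)) +
      w (t + 2) ω := by
  ext1 ω
  have h1 : M.predMean (fun k => y k ω) (t + 2) =
      act (M.A (t + 2)) (M.filtMean (fun k => y k ω) (t + 1)) := rfl
  rw [h1, hM.state_eq (t + 2) (by omega) ω, act_sub]
  simp only [Nat.add_one_sub_one]
  abel

/-- The fresh noise is orthogonal to the filtering error and to the observations so far, so
orthogonality survives and covariances add. -/
theorem isLinearEstimate_predict {t : ℕ}
    (h : IsLinearEstimate P (obsSpace y (t + 1)) (θ (t + 1))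
      (fun ω => M.filtMean (fun k => y k ω) (t + 1)) (M.filtCov (t + 1))) :
    IsLinearEstimate P (obsSpace y (t + 1)) (θ (t + 2))
      (fun ω => M.predMean (fun k => y k ω) (t + 2)) (M.predCov (t + 2)) := by
  have ht : 2 ≤ t + 2 := by omega
  have hpast := (hM.coordsIn_state (t + 1) (by omega) le_rfl).sub
    (h.coordsIn.mono (hM.obsSpace_le le_rfl le_rfl))
  have heL2 := hpast.mono (hM.le_squareIntegrable _)
  have hwL2 := hM.trans_mem_squareIntegrable ht
  have hew := moment_eq_zero_comm
    (hpast.mono (hM.le_orthSpace_trans (t + 1) ht (by omega))).moment_eq_zero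
  refine ⟨h.coordsIn.act (M.A (t + 2)), ?_, ?_, ?_⟩
  · rw [hM.predErr_eq]
    exact fun X hX => orthSpace_add_mem (orthSpace_act_mem _ (h.orth hX))
      (hM.le_orthSpace_trans (t + 1) ht (by omega) (hM.obsSpace_le le_rfl le_rfl hX))
  · rw [hM.predErr_eq, moment_add_self_of_orth (heL2.act _) hwL2, moment_act_left _ heL2
      (heL2.act _), moment_act_right _ heL2 heL2, h.moment_eq, hM.moment_trans ht, add_comm,
      ← Matrix.mul_assoc]
    · rfl
    · rw [moment_act_left _ heL2 hwL2, hew, Matrix.mul_zero]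
  · exact posDef_add_mul_mul_transpose h.posDef (M.Q_posDef _ ht)

/-- The Kalman filter computes the linear predictions. -/
theorem isLinearEstimate_pred (t : ℕ) : IsLinearEstimate P (obsSpace y t) (θ (t + 1))
    (fun ω => M.predMean (fun k => y k ω) (t + 1)) (M.predCov (t + 1)) := by
  induction t with
  | zero => exact hM.isLinearEstimate_init
  | succ t ih => exact hM.isLinearEstimate_predict (hM.isLinearEstimate_correct ih)

theorem isLinearEstimate_filt (t : ℕ) : IsLinearEstimate P (obsSpace y (t + 1)) (θ (t + 1))
    (fun ω => M.filtMean (fun k => y k ω) (t + 1)) (M.filtCov (t + 1)) :=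
  hM.isLinearEstimate_correct (hM.isLinearEstimate_pred t)

/-! ### The Rauch–Tung–Striebel smoother. -/

/-- A random vector known at time `t + 1` that is orthogonal to the state at time `t + 1` and to
the past observations is orthogonal to all observations. -/
theorem obsSpace_le_orthSpace {t : ℕ} {r : Ω → Vec d}
    (hr : CoordsIn (affineSpanOf (sources θ w v) (sourcesUpTo (t + 1) t)) r)
    (hobs : obsSpace y t ≤ orthSpace P r) (hstate : CoordsIn (orthSpace P r) (θ (t + 1))) (s : ℕ) :
    obsSpace y s ≤ orthSpace P r := by
  have hrL2 := hr.mono (hM.le_squareIntegrable _)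
  -- Later states arise from `θ (t + 1)` by matrices and fresh noises, which are orthogonal to `r`;
  -- the same holds for later observations.
  have hθ : ∀ k, t + 1 ≤ k → CoordsIn (orthSpace P r) (θ k) := by
    intro k hk
    induction k, hk using Nat.le_induction with
    | base => exact hstate
    | succ k hk ih =>
      rw [hM.state_succ (by omega)]
      exact (ih.act _).add ((coordsIn_orthSpace_iff hrL2
        (hM.trans_mem_squareIntegrable (by omega))).2 (moment_eq_zero_comm
        (hr.mono (hM.le_orthSpace_trans t (by omega) (by omega))).moment_eq_zero))
  refine affineSpanOf_le (hobs (one_mem_obsSpace y t)) fun k hk => ?_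
  rcases Nat.lt_or_ge t k with hlt | hle
  · rw [hM.obs_eq hk.1]
    exact ((hθ k hlt).act _).add ((coordsIn_orthSpace_iff hrL2
      (hM.meas_mem_squareIntegrable hk.1)).2 (moment_eq_zero_comm
      (hr.mono (hM.le_orthSpace_meas (t + 1) hk.1 hlt)).moment_eq_zero))
  · exact (coordsIn_affineSpanOf (ξ := y) (dim := fun _ => m) (T := Set.Icc 1 t)
      ⟨hk.1, hle⟩).mono hobs

/-- One backward step of the Rauch-Tung-Striebel smoother. -/
theorem isLinearEstimate_smooth {t s n : ℕ} (hts : t + 2 ≤ s)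
    (h : IsLinearEstimate P (obsSpace y s) (θ (t + 2))
      (fun ω => M.rtsMean (fun k => y k ω) n (t + 2)) (M.rtsCov n (t + 2))) :
    IsLinearEstimate P (obsSpace y s) (θ (t + 1))
      (fun ω => M.rtsMean (fun k => y k ω) (n + 1) (t + 1)) (M.rtsCov (n + 1) (t + 1)) := by
  have hf := hM.isLinearEstimate_filt t
  have hp := hM.isLinearEstimate_pred (t + 1)
  have ht : 2 ≤ t + 2 := by omega
  set S := M.filtCov (t + 1)
  set A := M.A (t + 2)
  set L := M.backGain (t + 1)
  set filt : Ω → Vec d := fun ω => M.filtMean (fun k => y k ω) (t + 1)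
  set pred : Ω → Vec d := fun ω => M.predMean (fun k => y k ω) (t + 2)
  set rts : Ω → Vec d := fun ω => M.rtsMean (fun k => y k ω) n (t + 2)
  set e : Ω → Vec d := fun ω => θ (t + 1) ω - filt ω with he
  set e' : Ω → Vec d := fun ω => θ (t + 2) ω - rts ω with he'
  have hpredErr : (fun ω => θ (t + 2) ω - pred ω) = fun ω => act A (e ω) + w (t + 2) ω :=
    hM.predErr_eq
  -- The error of estimating `θ (t + 1)` from the observations up to `t + 1` together with the next
  -- state `θ (t + 2)`. Given that state, later observations bring nothing new, so `r` will be
  -- orthogonal to all of them.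
  set r : Ω → Vec d := fun ω => e ω - act L (act A (e ω) + w (t + 2) ω) with hr
  have hpredCov : M.predCov (t + 2) = M.Q (t + 2) + A * S * A.transpose := rfl
  have hK : L * (M.Q (t + 2) + A * S * A.transpose) = S * A.transpose :=
    gain_mul_eq hf.posDef (M.Q_posDef _ ht)
  have hepast : CoordsIn (affineSpanOf (sources θ w v) (sourcesUpTo (t + 1) (t + 1))) e :=
    (hM.coordsIn_state (t + 1) (by omega) le_rfl).sub
      (hf.coordsIn.mono (hM.obsSpace_le le_rfl le_rfl))
  have hepast' : CoordsIn (affineSpanOf (sources θ w v) (sourcesUpTo (t + 2) (t + 1))) e :=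
    hepast.mono (affineSpanOf_mono (sourcesUpTo_subset (by omega) le_rfl))
  have heL2 := hepast.mono (hM.le_squareIntegrable _)
  have hwL2 := hM.trans_mem_squareIntegrable ht
  have hiL2 := (heL2.act A).add hwL2
  have hew : moment P e (w (t + 2)) = 0 := moment_eq_zero_comm
    (hepast.mono (hM.le_orthSpace_trans (t + 1) ht (by omega))).moment_eq_zero
  have hrpast : CoordsIn (affineSpanOf (sources θ w v) (sourcesUpTo (t + 2) (t + 1))) r :=
    hepast'.sub (((hepast'.act A).add (coordsIn_trans (t + 1) θ w v ht le_rfl)).act L)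
  have hrL2 := hrpast.mono (hM.le_squareIntegrable _)
  have hrobs : obsSpace y (t + 1) ≤ orthSpace P r := fun X hX =>
    orthSpace_sub_mem (hf.orth hX) (orthSpace_act_mem L (orthSpace_add_mem
      (orthSpace_act_mem A (hf.orth hX))
      (hM.le_orthSpace_trans (t + 1) ht (by omega) (hM.obsSpace_le le_rfl le_rfl hX))))
  have hrinn : CoordsIn (orthSpace P r) (fun ω => act A (e ω) + w (t + 2) ω) :=
    (coordsIn_orthSpace_iff hrL2 hiL2).2
      (moment_update_innovation heL2 hwL2 hf.moment_eq (hM.moment_trans ht) hew hK)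
  have hrcov := moment_update_self heL2 hwL2 hf.moment_eq (hM.moment_trans ht) hew hK
  have hrstate : CoordsIn (orthSpace P r) (θ (t + 2)) := by
    have h1 : θ (t + 2) = fun ω => (θ (t + 2) ω - pred ω) + pred ω := by
      ext1 ω; abel
    rw [h1]
    refine CoordsIn.add ?_ (hp.coordsIn.mono hrobs)
    rw [hpredErr]
    exact hrinn
  have hrall := hM.obsSpace_le_orthSpace hrpast hrobs hrstate
  have he'L2 : CoordsIn (squareIntegrable P) e' := (hM.state_mem_squareIntegrable (by omega)).sub
    (h.coordsIn.mono (hM.obsSpace_le_squareIntegrable s))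
  have hre' : CoordsIn (orthSpace P r) e' := hrstate.sub (h.coordsIn.mono (hrall s))
  -- The smoothing error splits into `r` and the propagated error `L e'`, which are orthogonal, so
  -- their covariances add.
  have herr : (fun ω => θ (t + 1) ω - M.rtsMean (fun k => y k ω) (n + 1) (t + 1)) =
      fun ω => r ω + act L (e' ω) := by
    ext1 ω
    have h1 : M.rtsMean (fun k => y k ω) (n + 1) (t + 1) =
        filt ω + act L (rts ω - pred ω) := rfl
    have h2 : r ω = θ (t + 1) ω - filt ω - act L (θ (t + 2) ω - pred ω) := by
      rw [show θ (t + 2) ω - pred ω = act A (e ω) + w (t + 2) ω from congrFun hpredErr ω]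
    rw [h1, h2, he', act_sub, act_sub, act_sub]
    abel
  have hposr : (S - L * A * S).PosDef := posDef_sub_gain_mul hf.posDef (M.Q_posDef _ ht) hK
  have hcov : M.rtsCov (n + 1) (t + 1) =
      (S - L * A * S) + L * M.rtsCov n (t + 2) * L.transpose := by
    have h1 : M.rtsCov (n + 1) (t + 1) =
        S + L * (M.rtsCov n (t + 2) - M.predCov (t + 2)) * L.transpose := rfl
    -- The transposed gain equation; it turns the subtracted term of the recursion into `L A S`.
    have h2 : M.predCov (t + 2) * L.transpose = A * S := by
      have hSt : S.transpose = S := hf.posDef.isHermitian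
      have hPt : (M.predCov (t + 2)).transpose = M.predCov (t + 2) := hp.posDef.isHermitian
      have h3 := congrArg Matrix.transpose hK
      rw [← hpredCov, Matrix.transpose_mul, Matrix.transpose_mul, hPt, hSt,
        Matrix.transpose_transpose] at h3
      exact h3
    rw [h1, Matrix.mul_sub, Matrix.sub_mul, Matrix.mul_assoc L (M.predCov (t + 2)), h2,
      ← Matrix.mul_assoc]
    abel
  refine ⟨?_, ?_, ?_, ?_⟩
  · exact (hf.coordsIn.mono (obsSpace_mono y (by omega))).add
      ((h.coordsIn.sub (hp.coordsIn.mono (obsSpace_mono y (by omega)))).act L)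
  · rw [herr]
    exact fun X hX => orthSpace_add_mem (hrall s hX) (orthSpace_act_mem L (h.orth hX))
  · rw [herr, hcov, moment_add_self_of_orth hrL2 (he'L2.act L), hrcov,
      moment_act_left L he'L2 (he'L2.act L), moment_act_right L he'L2 he'L2, h.moment_eq,
      ← Matrix.mul_assoc]
    rw [moment_act_right L hrL2 he'L2, hre'.moment_eq_zero, Matrix.zero_mul]
  · rw [hcov]
    exact hposr.add_posSemidef (posSemidef_mul_mul_transpose h.posDef.posSemidef L)

/-- The Rauch-Tung-Striebel smoother computes the linear estimates of past states. -/
theorem isLinearEstimate_rts {i t : ℕ} (hi : 1 ≤ i) (hit : i ≤ t) :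
    IsLinearEstimate P (obsSpace y t) (θ i)
      (fun ω => M.rtsMean (fun k => y k ω) (t - i) i) (M.rtsCov (t - i) i) := by
  obtain ⟨n, rfl⟩ := Nat.exists_eq_add_of_le hit
  obtain ⟨j, rfl⟩ := Nat.exists_eq_add_of_le' hi
  rw [Nat.add_sub_cancel_left]
  clear hi hit
  -- Induction on the distance to the final time; `j` must vary because the backward step uses the
  -- estimate of the next state.
  induction n generalizing j with
  | zero => exact hM.isLinearEstimate_filt j
  | succ n ih =>
    have h := ih (j + 1)
    rw [show j + 1 + 1 + n = j + 1 + (n + 1) by omega] at h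
    exact hM.isLinearEstimate_smooth (by omega) h

/-! ### From linear estimates to conditional laws. -/

omit hM [MeasurableSpace Ω] [IsProbabilityMeasure P] in
theorem exists_measurable_of_mem_obsSpace {t : ℕ} {X : Ω → ℝ} (hX : X ∈ obsSpace y t) :
    ∃ g : (Fin t → Vec m) → ℝ, Measurable g ∧ X = fun ω => g (obs y t ω) := by
  let 𝒮 : Submodule ℝ (Ω → ℝ) :=
    { carrier := {X | ∃ g : (Fin t → Vec m) → ℝ, Measurable g ∧ X = fun ω => g (obs y t ω)}
      add_mem' := by
        rintro _ _ ⟨g, hg, rfl⟩ ⟨g', hg', rfl⟩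
        exact ⟨fun u => g u + g' u, hg.add hg', rfl⟩
      zero_mem' := ⟨0, measurable_zero, rfl⟩
      smul_mem' := by
        rintro c _ ⟨g, hg, rfl⟩
        exact ⟨fun u => c * g u, hg.const_mul c, rfl⟩ }
  have h : obsSpace y t ≤ 𝒮 := by
    refine affineSpanOf_le ⟨1, measurable_one, rfl⟩ fun k hk a => ?_
    obtain ⟨j, rfl⟩ := Nat.exists_eq_add_of_le' hk.1
    refine ⟨fun u => u ⟨j, Nat.lt_of_succ_le hk.2⟩ a, by fun_prop, rfl⟩
  exact h hX

omit hM [MeasurableSpace Ω] [IsProbabilityMeasure P] in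
theorem exists_measurable_of_coordsIn_obsSpace {t n : ℕ} {U : Ω → Vec n}
    (hU : CoordsIn (obsSpace y t) U) :
    ∃ G : (Fin t → Vec m) → Vec n, Measurable G ∧ U = fun ω => G (obs y t ω) := by
  choose g hg hgU using fun a => exists_measurable_of_mem_obsSpace (hU a)
  refine ⟨fun u => WithLp.toLp 2 fun a => g a u, by fun_prop, ?_⟩
  ext ω a
  exact congrFun (hgU a) ω

omit [IsProbabilityMeasure P] in
theorem measurable_obs (t : ℕ) : Measurable (obs y t) :=
  measurable_pi_lambda _ fun k => hM.measurable_obs_apply (by omega)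

variable {i t : ℕ} {est : Ω → Vec d} {S : Matrix (Fin d) (Fin d) ℝ}

omit [IsProbabilityMeasure P] in
theorem error_mem_squareIntegrable (hi : 1 ≤ i)
    (h : IsLinearEstimate P (obsSpace y t) (θ i) est S) :
    CoordsIn (squareIntegrable P) (fun ω => θ i ω - est ω) :=
  (hM.state_mem_squareIntegrable hi).sub (h.coordsIn.mono (hM.obsSpace_le_squareIntegrable t))

/-- The bridge from L² geometry to probability: the estimate becomes a measurable function of the
observations, and orthogonality of the error becomes independence. -/
theorem exists_error_indep (hi : 1 ≤ i) (h : IsLinearEstimate P (obsSpace y t) (θ i) est S) :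
    ∃ G : (Fin t → Vec m) → Vec d, Measurable G ∧ (est = fun ω => G (obs y t ω)) ∧
      IndepFun (obs y t) (fun ω => θ i ω - G (obs y t ω)) P ∧
      P.map (fun ω => θ i ω - G (obs y t ω)) = multivariateGaussian 0 S := by
  obtain ⟨G, hG, hest⟩ := exists_measurable_of_coordsIn_obsSpace h.coordsIn
  -- The bound `i + t` covers the state `i` and the observations up to `t` whatever their order.
  have he : CoordsIn (affineSpanOf (sources θ w v) (sourcesUpTo (i + t) t))
      (fun ω => θ i ω - est ω) :=
    (hM.coordsIn_state t hi (by omega)).sub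
      (h.coordsIn.mono (hM.obsSpace_le (by omega) le_rfl))
  have h1 := h.orth (one_mem_obsSpace y t)
  have hlaw := map_eq_multivariateGaussian hM.hasGaussianLaw_sources hM.indep he h1
  have hind := indepFun_of_orthSpace hM.hasGaussianLaw_sources hM.indep he h1
    (y := fun (k : Fin t) => y (k + 1))
    (fun k => hM.coordsIn_obs (by omega) (by omega) (by omega))
    (fun k => (coordsIn_affineSpanOf (ξ := y) (dim := fun _ => m) (T := Set.Icc 1 t)
      ⟨by omega, by omega⟩).mono h.orth)
  rw [h.moment_eq] at hlaw
  subst hest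
  exact ⟨G, hG, rfl, hind, hlaw⟩

theorem isMAP_iff (hi : 1 ≤ i) (h : IsLinearEstimate P (obsSpace y t) (θ i) est S)
    (g : Ω → Vec d) : IsMAP P (θ i) (obs y t) g ↔ g =ᵐ[P] est := by
  obtain ⟨G, hG, rfl, hind, hlaw⟩ := hM.exists_error_indep hi h
  exact isMAP_iff_of_indepFun h.posDef (hM.measurable_state hi) (hM.measurable_obs t) hG hind hlaw g

theorem condExp_eq (hi : 1 ≤ i) (h : IsLinearEstimate P (obsSpace y t) (θ i) est S) :
    P[θ i | obsSigma y t] =ᵐ[P] est := by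
  obtain ⟨G, hG, rfl, hind, hlaw⟩ := hM.exists_error_indep hi h
  exact condExp_eq_of_indepFun (hM.measurable_state hi) (hM.measurable_obs t) hG hind hlaw
    ((hM.state_mem_squareIntegrable hi).memLp.integrable one_le_two)

theorem errCov_eq (hi : 1 ≤ i) (h : IsLinearEstimate P (obsSpace y t) (θ i) est S)
    {g : Ω → Vec d} (hg : g =ᵐ[P] est) : ∀ᵐ ω ∂P, errCov P (obsSigma y t) (θ i) g ω = S := by
  obtain ⟨G, hG, rfl, hind, -⟩ := hM.exists_error_indep hi h
  have := errCov_eq_of_indepFun (hM.measurable_state hi) (hM.measurable_obs t) hG hind hg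
  filter_upwards [this] with ω hω
  rw [hω]
  exact h.moment_eq

omit [IsProbabilityMeasure P] in
/-- More observations do not increase the error covariance. -/
theorem posSemidef_sub {s : ℕ} (hi : 1 ≤ i) (hst : s ≤ t) {est' : Ω → Vec d}
    {S' : Matrix (Fin d) (Fin d) ℝ} (hs : IsLinearEstimate P (obsSpace y s) (θ i) est' S')
    (ht : IsLinearEstimate P (obsSpace y t) (θ i) est S) : (S' - S).PosSemidef := by
  have hd : CoordsIn (obsSpace y t) (fun ω => est ω - est' ω) :=
    ht.coordsIn.sub (hs.coordsIn.mono (obsSpace_mono y hst))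
  have hdL2 := hd.mono (hM.obsSpace_le_squareIntegrable t)
  -- Pythagoras: the difference of the estimates lies in `obsSpace y t`, hence is orthogonal to the
  -- later error.
  have h1 : (fun ω => θ i ω - est' ω) = fun ω => (θ i ω - est ω) + (est ω - est' ω) := by
    ext1 ω; abel
  have h2 := hs.moment_eq
  rw [h1, moment_add_self_of_orth (hM.error_mem_squareIntegrable hi ht) hdL2
    (hd.mono ht.orth).moment_eq_zero, ht.moment_eq] at h2
  rw [← h2, add_sub_cancel_left]
  exact moment_posSemidef hdL2

omit [IsProbabilityMeasure P] in
theorem memLp_error (hi : 1 ≤ i) (h : IsLinearEstimate P (obsSpace y t) (θ i) est S)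
    {g : Ω → Vec d} (hg : g =ᵐ[P] est) : MemLp (fun ω => θ i ω - g ω) 2 P := by
  refine (hM.error_mem_squareIntegrable hi h).memLp.ae_eq ?_
  filter_upwards [hg] with ω hω
  rw [hω]

omit [IsProbabilityMeasure P] in
theorem integral_norm_sq_error (hi : 1 ≤ i) (h : IsLinearEstimate P (obsSpace y t) (θ i) est S)
    {g : Ω → Vec d} (hg : g =ᵐ[P] est) : ∫ ω, ‖θ i ω - g ω‖ ^ 2 ∂P = S.trace := by
  rw [← h.moment_eq, ← integral_norm_sq_eq_trace (hM.error_mem_squareIntegrable hi h)]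
  refine integral_congr_ae ?_
  filter_upwards [hg] with ω hω
  rw [hω]

end IsLGM

end LinearGaussian

/-! ### The main theorem. -/

theorem mainTheorem1 {Ω : Type*} [MeasurableSpace Ω] (P : Measure Ω) [IsProbabilityMeasure P]
    {d m : ℕ} (M : LinearGaussian.Params d m)
    (θ : ℕ → Ω → LinearGaussian.Vec d) (y : ℕ → Ω → LinearGaussian.Vec m)
    (w : ℕ → Ω → LinearGaussian.Vec d) (v : ℕ → Ω → LinearGaussian.Vec m)
    (hM : LinearGaussian.IsLGM P M θ y w v) :
    -- the MAP estimates exist and are exactly the versions of the conditional mean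
    (∀ i t : ℕ, 1 ≤ i → i ≤ t → ∀ g : Ω → LinearGaussian.Vec d,
      LinearGaussian.IsMAP P (θ i) (LinearGaussian.obs y t) g ↔
        g =ᵐ[P] P[θ i | LinearGaussian.obsSigma y t]) ∧
    -- the error covariance and the mean squared error of the MAP estimate do not increase
    (∀ i s t : ℕ, 1 ≤ i → i ≤ s → s ≤ t → ∀ gs gt : Ω → LinearGaussian.Vec d,
      LinearGaussian.IsMAP P (θ i) (LinearGaussian.obs y s) gs →
      LinearGaussian.IsMAP P (θ i) (LinearGaussian.obs y t) gt →
        (∀ᵐ ω ∂P, (LinearGaussian.errCov P (LinearGaussian.obsSigma y s) (θ i) gs ω -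
          LinearGaussian.errCov P (LinearGaussian.obsSigma y t) (θ i) gt ω).PosSemidef) ∧
        MemLp (fun ω => θ i ω - gs ω) 2 P ∧ MemLp (fun ω => θ i ω - gt ω) 2 P ∧
        ∫ ω, ‖θ i ω - gt ω‖ ^ 2 ∂P ≤ ∫ ω, ‖θ i ω - gs ω‖ ^ 2 ∂P) ∧
    -- Kalman filtering followed by smoothing computes the MAP estimates and error covariances
    (∀ i t : ℕ, 1 ≤ i → i ≤ t →
      LinearGaussian.IsMAP P (θ i) (LinearGaussian.obs y t)
        (fun ω => M.rtsMean (fun k => y k ω) (t - i) i) ∧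
      ∀ g : Ω → LinearGaussian.Vec d,
        LinearGaussian.IsMAP P (θ i) (LinearGaussian.obs y t) g →
        ∀ᵐ ω ∂P, LinearGaussian.errCov P (LinearGaussian.obsSigma y t) (θ i) g ω =
          M.rtsCov (t - i) i) := by
  refine ⟨fun i t hi hit g => ?_, fun i s t hi his hst gs gt hgs hgt => ?_,
    fun i t hi hit => ⟨?_, fun g hg => ?_⟩⟩
  · have h := hM.isLinearEstimate_rts hi hit
    rw [hM.isMAP_iff hi h]
    exact ⟨fun hg => hg.trans (hM.condExp_eq hi h).symm, fun hg => hg.trans (hM.condExp_eq hi h)⟩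
  · have hs := hM.isLinearEstimate_rts hi his
    have ht := hM.isLinearEstimate_rts hi (his.trans hst)
    rw [hM.isMAP_iff hi hs] at hgs
    rw [hM.isMAP_iff hi ht] at hgt
    have hpos := hM.posSemidef_sub hi hst hs ht
    refine ⟨?_, hM.memLp_error hi hs hgs, hM.memLp_error hi ht hgt, ?_⟩
    · filter_upwards [hM.errCov_eq hi hs hgs, hM.errCov_eq hi ht hgt] with ω h1 h2
      rw [h1, h2]
      exact hpos
    · rw [hM.integral_norm_sq_error hi hs hgs, hM.integral_norm_sq_error hi ht hgt, ← sub_nonneg,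
        ← Matrix.trace_sub]
      exact hpos.trace_nonneg
  · exact (hM.isMAP_iff hi (hM.isLinearEstimate_rts hi hit) _).2 Filter.EventuallyEq.rfl
  · have h := hM.isLinearEstimate_rts hi hit
    exact hM.errCov_eq hi h ((hM.isMAP_iff hi h g).1 hg)
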